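/- **Setting.** Let $K$ be a compact connected metric space and $F_0,\dots,F_{N-1}:K\to K$ ($N\ge 3$) injective contractions with $K=\bigcup_l F_lK$. For a word $w=w_1\cdots w_m$ put $F_w=F_{w_1}\circ\cdots\circ F_{w_m}$. Let $V_0=\{q_0,q_1,q_2\}\subset K$ consist of three distinct points with $F_lq_l=q_l$, where $q_l$ belongs to no cell $F_{l'}K$ with $l'\ne l$, and suppose that $F_wK\cap F_{w'}K\subset F_wV_0\cap F_{w'}V_0$ for different words $w,w'$ of equal length. Put $V_m=\bigcup_{|w|=m}F_wV_0$, $V_*=\bigcup_m V_m$. Let $\mathcal E_0(u)=\sum_{i<j}(u(q_i)-u(q_j))^2$ and let $0<r_l<1$ be such that the restriction to $V_0$ (minimum over extensions) of $\mathcal E_1(f)=\sum_l r_l^{-1}\mathcal E_0(f\circ F_l)$ is $\mathcal E_0$ (regular harmonic structure). Put $\mathcal E_m(f)=\sum_{|w|=m}r_w^{-1}\mathcal E_0(f\circ F_w)=\sum_{x\sim_m y}c_{xy}(f(x)-f(y))^2$ with $r_w=r_{w_1}\cdots r_{w_m}$, where $x\sim_m y$ means that $x\neq y$ lie in $F_wV_0$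 for some $|w|=m$. A harmonic function is a continuous function on $K$ that minimizes the energy from level $m$ to level $m+1$ for every $m$. Let $\mu$ be the self-similar probability measure with weights $\mu_l>0$, $\sum_l\mu_l=1$; put $\mu_w=\mu_{w_1}\cdots\mu_{w_m}$. Assume: * ($D3$ symmetry) every permutation of $V_0$ is induced by a homeomorphism of $K$ that preserves $\mu$ and, for every $m$, the graph on $V_m$ with its conductances $c_{xy}$; * $r_l\mu_l=\rho$ for all $0\le l<N$, where $\rho=r\mu$, and $r=r_0=r_1=r_2$, $\mu=\mu_0=\mu_1=\mu_2$ (as weights); * the matrices $M_l$ ($l=0,1,2$) of the maps $h\mapsto h\circ F_l$ on harmonic functions (identified with their values on $V_0$) are nondegenerate. Let $1,r,\lambda$ be the eigenvalues of $M_0$. For $x\in V_m\setminus V_0$ let $\Delta_mf(x)=\sum_{y\sim_mx}c_{xy}(f(y)-f(x))$ and $\tilde\Delta_mf(x)=\big(\int_K\psi^m_x\,d\mu\big)^{-1}\Delta_mf(x)$, where $\psi^m_x$ is continuous, harmonic on every $m$-cell, equal to $1$ at $x$ and to $0$ on $V_m\setminus\{x\}$. We write $\Delta f=g$ if $f,g$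 are continuous on $K$ and $\tilde\Delta_mf\to g$ uniformly on $V_*\setminus V_0$; $\mathcal H_n$ is the space of solutions of $\Delta^{n+1}h=0$ on $K$. With indices modulo $3$, let $$\partial_nf(q_l)=\lim_{k\to\infty} r^{-k}\big(2f(q_l)-f(F_l^kq_{l+1})-f(F_l^kq_{l-1})\big),\qquad \partial_Tf(q_l)=\lim_{k\to\infty}\lambda^{-k}\big(f(F_l^kq_{l+1})-f(F_l^kq_{l-1})\big).$$ For $j\ge0$ let $Q_{j1}^{(0)}\in\mathcal H_j$ be the monomial determined by $\Delta^iQ_{j1}^{(0)}(q_0)=\delta_{ij}$ and $\partial_n\Delta^iQ_{j1}^{(0)}(q_0)=\partial_T\Delta^iQ_{j1}^{(0)}(q_0)=0$ for $0\le i\le j$, and put $\alpha_j=Q_{j1}^{(0)}(q_1)$. For $x\in V_m\setminus V_0$ let $U_m(x)$ be the union of the cells $F_wK$ with $|w|=m$ that contain $x$, and let $\mathcal H_n(U_m(x))$ be the set of functions $h$ on $U_m(x)$ with $h\circ F_w\in\mathcal H_n$ for each such $w$, such that for $0\le i\le n$ the function $\Delta^ih$ (given on $F_wK$ by $(\Delta^ih)\circ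 F_w=(r_w\mu_w)^{-i}\Delta^i(h\circ F_w)$) has the same value $\Delta^ih(x)$ at $x$ in all these cells and satisfies the matching condition $\sum_{(w,l):\,|w|=m,\,F_wq_l=x}r_w^{-1}\,\partial_n\big((\Delta^ih)\circ F_w\big)(q_l)=0$. **Lemma 4.3.** Let $n,m\ge0$, $x\in V_m\setminus V_0$ and $h\in\mathcal H_n(U_m(x))$. Then $$\tilde\Delta_mh(x)=\sum_{j=1}^n\rho^{m(j-1)}\,\alpha_1^{-1}\alpha_j\,\Delta^jh(x).$$ Moreover $\alpha_1=1/6$. -/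

import Mathlib

open Filter Topology MeasureTheory
open scoped NNReal

noncomputable section

/-- For a word `w = w₁ ⋯ w_m`, the composition `F_w = F_{w₁} ∘ ⋯ ∘ F_{w_m}`. -/
def cellMap {A K : Type*} (F : A → K → K) : {m : ℕ} → (Fin m → A) → K → K
  | 0, _ => id
  | _ + 1, w => F (w 0) ∘ cellMap F (Fin.tail w)

/-- The energy on the complete graph with three vertices, all conductances being `1`. -/
def triangleEnergy (u : Fin 3 → ℝ) : ℝ :=
  ∑ i : Fin 3, ∑ j : Fin 3, if i < j then (u i - u j) ^ 2 else 0

/-- A p.c.f. self-similar structure `(K, N, {F_l})` on a compact connected metric space `K` whose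
boundary `V₀ = {q₀, q₁, q₂}` consists of three points, `q_l` being the fixed point of `F_l`. -/
structure PcfTriangle (K : Type*) [MetricSpace K] where
  N : ℕ
  three_le : 3 ≤ N
  F : Fin N → K → K
  contracting : ∀ l, ∃ c : ℝ≥0, c < 1 ∧ LipschitzWith c (F l)
  injective : ∀ l, Function.Injective (F l)
  /-- `K = ⋃ F_l K` -/
  cover : ∀ x, ∃ l y, F l y = x
  q : Fin 3 → K
  q_injective : Function.Injective q
  q_fixed : ∀ i : Fin 3, F (Fin.castLE three_le i) (q i) = q i
  /-- `F_w K ∩ F_{w'} K ⊆ F_w V₀ ∩ F_{w'} V₀` for different words of the same length -/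
  inter_subset : ∀ (m : ℕ) (w w' : Fin m → Fin N), w ≠ w' →
    Set.range (cellMap F w) ∩ Set.range (cellMap F w') ⊆
      (cellMap F w '' Set.range q) ∩ (cellMap F w' '' Set.range q)
  /-- The boundary point `q_l` lies in the single cell `F_l K` of level one (otherwise the
  postcritical set would be infinite). -/
  q_simple : ∀ (l : Fin N) (i : Fin 3), q i ∈ Set.range (F l) → l = Fin.castLE three_le i

/-- A p.c.f. self-similar structure with three boundary points, together with a regular harmonic
structure whose conductances on `V₀` are all `1`, and a self-similar probability measure. -/
structure AnalyticTriangle (K : Type*) [MetricSpace K] [MeasurableSpace K]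
    extends PcfTriangle K where
  /-- renormalization factors -/
  r : Fin N → ℝ
  r_pos : ∀ l, 0 < r l
  r_lt_one : ∀ l, r l < 1
  /-- The energy `∑ r_l⁻¹ 𝓔₀(f ∘ F_l)` on `V₁`, restricted to `V₀`, is the energy `𝓔₀` on `V₀`. -/
  harmonic_structure : ∀ u : Fin 3 → ℝ,
    IsLeast {e : ℝ | ∃ f : K → ℝ, (∀ i, f (q i) = u i) ∧
      e = ∑ l, (r l)⁻¹ * triangleEnergy (fun i => f (F l (q i)))} (triangleEnergy u)
  /-- weights of the self-similar measure -/
  wt : Fin N → ℝ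
  wt_pos : ∀ l, 0 < wt l
  wt_sum : ∑ l, wt l = 1
  /-- the self-similar measure -/
  μ : Measure K
  μ_prob : IsProbabilityMeasure μ
  μ_selfSimilar : ∀ A : Set K, MeasurableSet A →
    μ A = ∑ l, ENNReal.ofReal (wt l) * μ (F l ⁻¹' A)

namespace AnalyticTriangle

variable {K : Type*} [MetricSpace K] [MeasurableSpace K] (S : AnalyticTriangle K)

/-- Words of length `m`. -/
abbrev Word (m : ℕ) : Type := Fin m → Fin S.N

/-- The letter `l ∈ {0, …, N - 1}` belonging to the boundary point `q_l`. -/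
def letter (l : Fin 3) : Fin S.N := Fin.castLE S.three_le l

/-- `F_w` -/
def Fw {m : ℕ} (w : S.Word m) : K → K := cellMap S.F w

/-- `r_w = r_{w₁} ⋯ r_{w_m}` -/
def rw {m : ℕ} (w : S.Word m) : ℝ := ∏ i, S.r (w i)

/-- `μ_w = μ_{w₁} ⋯ μ_{w_m}` -/
def μw {m : ℕ} (w : S.Word m) : ℝ := ∏ i, S.wt (w i)

/-- The common value of `r_l` for `l = 0, 1, 2`, in the `D3` symmetric case. -/
def r0 : ℝ := S.r (S.letter 0)

/-- `ρ = r μ`, where `r` and `μ` belong to the letters `0, 1, 2` -/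
def ρ : ℝ := S.r (S.letter 0) * S.wt (S.letter 0)

open Classical in
/-- The vertices `V_m = ⋃_{|w| = m} F_w V₀`. -/
def V (m : ℕ) : Finset K :=
  Finset.univ.image (fun p : S.Word m × Fin 3 => S.Fw p.1 (S.q p.2))

open Classical in
/-- The conductance `c_{xy}` on the graph `G_m`: the edge joining `x = F_w q_i` to `y = F_w q_j`,
`i ≠ j`, has conductance `r_w⁻¹` (should several `m`-cells contain both `x` and `y`, their
conductances are added up, as in the energy `𝓔_m`). It is `0` if `x` and `y` are not adjacent. -/
def cond (m : ℕ) (x y : K) : ℝ :=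
  ∑ w : S.Word m, ∑ i : Fin 3, ∑ j : Fin 3,
    if i ≠ j ∧ S.Fw w (S.q i) = x ∧ S.Fw w (S.q j) = y then (S.rw w)⁻¹ else 0

/-- The graph energy `𝓔_m(f) = ∑_{|w| = m} r_w⁻¹ 𝓔₀(f ∘ F_w)`. -/
def energy (m : ℕ) (f : K → ℝ) : ℝ :=
  ∑ w : S.Word m, (S.rw w)⁻¹ * triangleEnergy (fun i => f (S.Fw w (S.q i)))

/-- `h` is harmonic: it is continuous and minimizes the energy from level `m` to level `m + 1`,
for each `m`. -/
def IsHarmonic (h : K → ℝ) : Prop :=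
  Continuous h ∧ ∀ (m : ℕ) (f : K → ℝ), (∀ x ∈ S.V m, f x = h x) →
    S.energy (m + 1) h ≤ S.energy (m + 1) f

open Classical in
/-- The harmonic function with boundary values `u` on `V₀`. -/
def harmExt (u : Fin 3 → ℝ) : K → ℝ :=
  if H : ∃ h, S.IsHarmonic h ∧ ∀ i, h (S.q i) = u i then H.choose else 0

/-- The `l`-th harmonic extension matrix: the matrix of `h ↦ h ∘ F_l` on the harmonic functions,
which are identified with their boundary values. -/
def extMatrix (l : Fin S.N) : Matrix (Fin 3) (Fin 3) ℝ :=
  Matrix.of fun i j => S.harmExt (Pi.single j 1) (S.F l (S.q i))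

/-- The harmonic extension matrices `M₀, M₁, M₂` are nondegenerate. -/
def Nondegenerate : Prop := ∀ l : Fin 3, (S.extMatrix (S.letter l)).det ≠ 0

/-- The third eigenvalue `λ` of the harmonic extension matrix `M₀`, the first two being `1` and
`r`; the three of them add up to the trace. -/
def lam : ℝ := (S.extMatrix (S.letter 0)).trace - 1 - S.r0

/-- The tent function at `x ∈ V_m`: continuous, harmonic on each `m`-cell, with value `1` at `x`
and `0` at the other vertices in `V_m`. -/
def IsTent (m : ℕ) (x : K) (ψ : K → ℝ) : Prop :=
  Continuous ψ ∧ (∀ w : S.Word m, S.IsHarmonic (ψ ∘ S.Fw w)) ∧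
    ψ x = 1 ∧ ∀ y ∈ S.V m, y ≠ x → ψ y = 0

open Classical in
/-- The tent function `ψ_x^m`. -/
def tent (m : ℕ) (x : K) : K → ℝ :=
  if H : ∃ ψ, S.IsTent m x ψ then H.choose else 0

/-- The graph Laplacian `Δ_m f(x) = ∑_{y ∼_m x} c_{xy} (f(y) - f(x))`. -/
def graphLap (m : ℕ) (f : K → ℝ) (x : K) : ℝ :=
  ∑ y ∈ S.V m, S.cond m x y * (f y - f x)

/-- The renormalized graph Laplacian `(∫ ψ_x^m dμ)⁻¹ Δ_m f(x)`. -/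
def renGraphLap (m : ℕ) (f : K → ℝ) (x : K) : ℝ :=
  (∫ y, S.tent m x y ∂S.μ)⁻¹ * S.graphLap m f x

/-- `f ∈ dom Δ_μ` and `Δ_μ f = g`: both are continuous and the renormalized graph Laplacians of `f`
converge to `g` uniformly on `V_* \ V₀` (the one of level `m` being defined on `V_m \ V₀`). -/
def IsLaplacian (f g : K → ℝ) : Prop :=
  Continuous f ∧ Continuous g ∧ ∀ ε > 0, ∃ M : ℕ, ∀ m ≥ M, ∀ x ∈ S.V m, x ∉ S.V 0 →
    |S.renGraphLap m f x - g x| < ε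

/-- `f ∈ dom Δ_μ` -/
def InDomLap (f : K → ℝ) : Prop := ∃ g, S.IsLaplacian f g

open Classical in
/-- `Δ_μ f` for `f ∈ dom Δ_μ` -/
def lap (f : K → ℝ) : K → ℝ :=
  if H : S.InDomLap f then H.choose else 0

/-- `h ∈ 𝓗_n`: `h` is `(n + 1)`-harmonic on `K`, that is `Δ_μ^{n+1} h = 0`. -/
def MemH (n : ℕ) (h : K → ℝ) : Prop :=
  (∀ i ≤ n, S.InDomLap (S.lap^[i] h)) ∧ S.lap^[n + 1] h = 0

/-- The normal derivative `∂_n f(q_l)` exists and equals `d` (cyclic notation in `l`). -/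
def HasNormalDeriv (f : K → ℝ) (l : Fin 3) (d : ℝ) : Prop :=
  Tendsto (fun k : ℕ => ((S.r (S.letter l)) ^ k)⁻¹ *
    (2 * f (S.q l) - f ((S.F (S.letter l))^[k] (S.q (l + 1)))
      - f ((S.F (S.letter l))^[k] (S.q (l - 1))))) atTop (𝓝 d)

/-- The transverse derivative `∂_T f(q_l)` exists and equals `d`. -/
def HasTransDeriv (f : K → ℝ) (l : Fin 3) (d : ℝ) : Prop :=
  Tendsto (fun k : ℕ => (S.lam ^ k)⁻¹ *
    (f ((S.F (S.letter l))^[k] (S.q (l + 1)))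
      - f ((S.F (S.letter l))^[k] (S.q (l - 1))))) atTop (𝓝 d)

/-- `Q` is the monomial `Q_{jk}^{(l)}` in `𝓗_n`, where `0 ≤ j ≤ n` and `k = 1, 2, 3`. -/
def IsMonomial (n : ℕ) (l : Fin 3) (j k : ℕ) (Q : K → ℝ) : Prop :=
  S.MemH n Q ∧ ∀ i ≤ n,
    S.lap^[i] Q (S.q l) = (if i = j ∧ k = 1 then 1 else 0) ∧
    S.HasNormalDeriv (S.lap^[i] Q) l (if i = j ∧ k = 2 then 1 else 0) ∧
    S.HasTransDeriv (S.lap^[i] Q) l (if i = j ∧ k = 3 then 1 else 0)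

open Classical in
/-- The monomial `Q_{jk}^{(l)}`; it does not depend on `n ≥ j`, so that `n = j` may be taken. -/
def monomial (l : Fin 3) (j k : ℕ) : K → ℝ :=
  if H : ∃ Q, S.IsMonomial j l j k Q then H.choose else 0

/-- `α_j = Q_{j1}^{(0)}(q₁)` -/
def α (j : ℕ) : ℝ := S.monomial 0 j 1 (S.q 1)

/-- `D3` symmetry: each permutation of the boundary is induced by a homeomorphism of `K` which
leaves the graphs `G_m`, with their conductances, and the measure invariant. -/
def IsD3Symmetric : Prop :=
  ∀ σ : Equiv.Perm (Fin 3), ∃ g : K ≃ₜ K,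
    (∀ i, g (S.q i) = S.q (σ i)) ∧
    (∀ (m : ℕ) (x y : K), S.cond m (g x) (g y) = S.cond m x y) ∧
    S.μ.map g = S.μ

/-- For `h` defined on a neighbourhood containing the cell `F_w K`, the function `(Δ_μ^j h) ∘ F_w`
on `K`, where `Δ_μ^j h` is computed in the cell by the scaling identity
`Δ_μ (h ∘ F_w) = r_w μ_w (Δ_μ h) ∘ F_w`. -/
def cellLap {m : ℕ} (w : S.Word m) (j : ℕ) (h : K → ℝ) : K → ℝ :=
  fun p => ((S.rw w * S.μw w) ^ j)⁻¹ * S.lap^[j] (h ∘ S.Fw w) p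

open Classical in
/-- The pairs `(w, l)` with `|w| = m` and `x = F_w q_l`; for `x ∈ V_m` the neighbourhood `U_m(x)` is
the union of the corresponding cells `F_w K`. -/
def cellsAt (m : ℕ) (x : K) : Finset (S.Word m × Fin 3) :=
  Finset.univ.filter fun p => S.Fw p.1 (S.q p.2) = x

/-- `h ∈ 𝓗_n(U_m(x))` (only the values of `h` on `U_m(x)` matter): `h ∘ F_w ∈ 𝓗_n` for each
`m`-cell `F_w K` containing `x`, and for `0 ≤ i ≤ n` the function `Δ_μ^i h` has one and the same
value at `x` in all these cells, and satisfies the matching condition at `x`: its normal derivatives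
`∂_n^w Δ_μ^i h(x) = r_w⁻¹ ∂_n ((Δ_μ^i h) ∘ F_w)(q_l)` add up to `0`. -/
def MemLocalH (n m : ℕ) (x : K) (h : K → ℝ) : Prop :=
  (∀ p ∈ S.cellsAt m x, S.MemH n (h ∘ S.Fw p.1)) ∧
  ∀ i ≤ n,
    (∀ p ∈ S.cellsAt m x, ∀ p' ∈ S.cellsAt m x,
      S.cellLap p.1 i h (S.q p.2) = S.cellLap p'.1 i h (S.q p'.2)) ∧
    ∃ d : S.Word m × Fin 3 → ℝ,
      (∀ p ∈ S.cellsAt m x, S.HasNormalDeriv (S.cellLap p.1 i h) p.2 (d p)) ∧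
      ∑ p ∈ S.cellsAt m x, (S.rw p.1)⁻¹ * d p = 0

end AnalyticTriangle

end

/-! The Laplacian is handled through a weak form, `IsWeak u g`. It says that at every level `m` the
energy of `u` against `v` is its boundary energy, plus the integral of `g` against the harmonic
function with the values of `v` on `V₀`, minus the integral of `g` against the piecewise harmonic
interpolation of `v` on `V_m`. By `isLaplacian_iff` this is equivalent to uniform convergence of the
renormalized graph Laplacians. One direction is uniform continuity of `g`. The other solves the
Dirichlet problem by a self-similar fixed point (`exists_isWeak_of_continuous`) and identifies the
solution by the maximum principle. Testing the weak form with indicators of vertices gives the graph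
Laplacian, and shows that the normal derivative at `q_l` exists and is `flux l (bd u) + moment g l`
(`IsWeak.hasNormalDeriv`).

Now `-Δ_m h(x)` is the sum, over the cells `F_w K` having `x` as a corner, of `r_w⁻¹` times the flux
of `h ∘ F_w` at that corner. Carrying each corner to `q₀` by a symmetry and adding with weights
`r_w⁻¹` condenses these cells into a single `f ∈ 𝓗_n`. The matching conditions make all normal
derivatives of `Δ^i f` at `q₀` vanish, and `r_w μ_w = ρ^m` gives `Δ^j f(q₀) = R ρ^{mj} Δ^j h(x)`
with `R = ∑ r_w⁻¹`.

Subtract from `f` the sum of `Δ^j f(q₀) Q_{j1}`. What remains has vanishing values and normal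
derivatives of all orders at `q₀`, so its part symmetric under the reflection fixing `q₀` is zero
and its flux at `q₀` vanishes. Since `Q_{j1}` has flux `-2 α_j` for `j ≥ 1` and `0` for `j = 0`,
this gives `Δ_m h(x) = 2 R ∑ α_j ρ^{mj} Δ^j h(x)` (`IsChain.flux_eq_sum`). The tent function has
integral `R ρ^m / 3`, so the quotient carries the factor `6`. Finally `α₁ = 1/6`, because the
vanishing normal derivative of `Q_{11}` reads `-2 α₁ + 1/3 = 0`, where `1/3` is the integral of the
harmonic function with boundary values `1, 0, 0`. -/

noncomputable section

namespace AnalyticTriangle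

/-! ### Words, cells and the density of the vertices -/

section Words

variable {K : Type*} [MetricSpace K] [MeasurableSpace K] (S : AnalyticTriangle K)

/-- The word `l w` obtained by prepending a letter. -/
def consWord {m : ℕ} (l : Fin S.N) (w : S.Word m) : S.Word (m + 1) := Fin.cons l w

lemma exists_consWord {m : ℕ} (w : S.Word (m + 1)) : ∃ l w', w = S.consWord l w' :=
  ⟨w 0, Fin.tail w, (Fin.cons_self_tail w).symm⟩

lemma Fw_consWord {m : ℕ} (l : Fin S.N) (w : S.Word m) (y : K) :
    S.Fw (S.consWord l w) y = S.F l (S.Fw w y) := by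
  simp [Fw, cellMap, consWord]

lemma comp_Fw_consWord {m : ℕ} (l : Fin S.N) (w : S.Word m) (f : K → ℝ) :
    f ∘ S.Fw (S.consWord l w) = (f ∘ S.F l) ∘ S.Fw w := by
  funext y; simp [Fw_consWord]

lemma Fw_zero (w : S.Word 0) : S.Fw w = id := rfl

lemma rw_consWord {m : ℕ} (l : Fin S.N) (w : S.Word m) :
    S.rw (S.consWord l w) = S.r l * S.rw w := by
  simp [rw, consWord, Fin.prod_univ_succ]

lemma μw_consWord {m : ℕ} (l : Fin S.N) (w : S.Word m) :
    S.μw (S.consWord l w) = S.wt l * S.μw w := by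
  simp [μw, consWord, Fin.prod_univ_succ]

lemma rw_pos {m : ℕ} (w : S.Word m) : 0 < S.rw w := Finset.prod_pos fun _ _ => S.r_pos _

lemma μw_pos {m : ℕ} (w : S.Word m) : 0 < S.μw w := Finset.prod_pos fun _ _ => S.wt_pos _

lemma sum_word_zero {M : Type*} [AddCommMonoid M] (f : S.Word 0 → M) :
    ∑ w, f w = f Fin.elim0 := by
  rw [Fintype.sum_unique]; congr 1

lemma sum_word_succ {M : Type*} [AddCommMonoid M] {m : ℕ} (f : S.Word (m + 1) → M) :
    ∑ w, f w = ∑ l, ∑ w : S.Word m, f (S.consWord l w) := by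
  rw [← (Fin.consEquiv (fun _ : Fin (m + 1) => Fin S.N)).sum_comp, Fintype.sum_prod_type]
  rfl

lemma F_continuous (l : Fin S.N) : Continuous (S.F l) := by
  obtain ⟨c, -, hc⟩ := S.contracting l
  exact hc.continuous

lemma Fw_continuous {m : ℕ} (w : S.Word m) : Continuous (S.Fw w) := by
  induction m with
  | zero => exact continuous_id
  | succ m ih =>
    obtain ⟨l, w, rfl⟩ := S.exists_consWord w
    have : S.Fw (S.consWord l w) = S.F l ∘ S.Fw w := funext (S.Fw_consWord l w)
    rw [this]
    exact (S.F_continuous l).comp (ih w)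

lemma Fw_injective {m : ℕ} (w : S.Word m) : Function.Injective (S.Fw w) := by
  induction m with
  | zero => exact Function.injective_id
  | succ m ih =>
    obtain ⟨l, w, rfl⟩ := S.exists_consWord w
    have : S.Fw (S.consWord l w) = S.F l ∘ S.Fw w := funext (S.Fw_consWord l w)
    rw [this]
    exact (S.injective l).comp (ih w)

lemma exists_Fw_eq (m : ℕ) (x : K) : ∃ (w : S.Word m) (y : K), S.Fw w y = x := by
  induction m generalizing x with
  | zero => exact ⟨Fin.elim0, x, rfl⟩
  | succ m ih =>
    obtain ⟨l, y, rfl⟩ := S.cover x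
    obtain ⟨w, z, rfl⟩ := ih y
    exact ⟨S.consWord l w, z, S.Fw_consWord l w z⟩

lemma exists_lipschitz_const : ∃ c : ℝ, 0 ≤ c ∧ c < 1 ∧
    ∀ l x y, dist (S.F l x) (S.F l y) ≤ c * dist x y := by
  choose c hc1 hc using S.contracting
  have hN : (Finset.univ : Finset (Fin S.N)).Nonempty := ⟨S.letter 0, by simp⟩
  refine ⟨Finset.univ.sup' hN (fun l => (c l : ℝ)), ?_, ?_, fun l x y => ?_⟩
  · exact (c hN.choose).2.trans (Finset.le_sup' (fun l => (c l : ℝ)) hN.choose_spec)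
  · rw [Finset.sup'_lt_iff]; intro l _; exact_mod_cast hc1 l
  · refine ((hc l).dist_le_mul x y).trans ?_
    exact mul_le_mul_of_nonneg_right (Finset.le_sup' (fun l => (c l : ℝ)) (Finset.mem_univ l))
      dist_nonneg

lemma exists_forall_dist_Fw_lt [CompactSpace K] {δ : ℝ} (hδ : 0 < δ) :
    ∃ M : ℕ, ∀ m ≥ M, ∀ (w : S.Word m) (x y : K), dist (S.Fw w x) (S.Fw w y) < δ := by
  obtain ⟨c, hc0, hc1, hc⟩ := S.exists_lipschitz_const
  have hw : ∀ (m : ℕ) (w : S.Word m) (x y : K),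
      dist (S.Fw w x) (S.Fw w y) ≤ c ^ m * dist x y := by
    intro m
    induction m with
    | zero => intro w x y; simp [Fw_zero]
    | succ m ih =>
      intro w x y
      obtain ⟨l, w, rfl⟩ := S.exists_consWord w
      rw [Fw_consWord, Fw_consWord, pow_succ', mul_assoc]
      exact (hc l _ _).trans (mul_le_mul_of_nonneg_left (ih w x y) hc0)
  have hD : ∀ x y : K, dist x y ≤ Metric.diam (Set.univ : Set K) := fun x y =>
    Metric.dist_le_diam_of_mem isCompact_univ.isBounded (Set.mem_univ x) (Set.mem_univ y)
  have hlim : Tendsto (fun m : ℕ => c ^ m * Metric.diam (Set.univ : Set K)) atTop (𝓝 0) := by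
    simpa using (tendsto_pow_atTop_nhds_zero_of_lt_one hc0 hc1).mul_const
      (Metric.diam (Set.univ : Set K))
  obtain ⟨M, hM⟩ := eventually_atTop.1 (hlim.eventually (gt_mem_nhds hδ))
  refine ⟨M, fun m hm w x y => lt_of_le_of_lt ?_ (hM m hm)⟩
  exact (hw m w x y).trans (mul_le_mul_of_nonneg_left (hD x y) (pow_nonneg hc0 m))

lemma mem_V {m : ℕ} {x : K} : x ∈ S.V m ↔ ∃ (w : S.Word m) (i : Fin 3), S.Fw w (S.q i) = x := by
  simp [V]

lemma mem_V_zero {x : K} : x ∈ S.V 0 ↔ ∃ i, S.q i = x := by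
  rw [mem_V]
  exact ⟨fun ⟨_, i, h⟩ => ⟨i, h⟩, fun ⟨i, h⟩ => ⟨Fin.elim0, i, h⟩⟩

lemma F_letter_q (i : Fin 3) : S.F (S.letter i) (S.q i) = S.q i := S.q_fixed i

lemma Fw_const {m : ℕ} (l : Fin S.N) : S.Fw (fun _ : Fin m => l) = (S.F l)^[m] := by
  induction m with
  | zero => rfl
  | succ m ih =>
    rw [Function.iterate_succ', ← ih]; rfl

lemma V_subset_succ (m : ℕ) : S.V m ⊆ S.V (m + 1) := by
  intro x hx
  induction m generalizing x with
  | zero =>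
    obtain ⟨i, rfl⟩ := S.mem_V_zero.1 hx
    exact S.mem_V.2 ⟨S.consWord (S.letter i) Fin.elim0, i, by
      rw [Fw_consWord, Fw_zero]; exact S.F_letter_q i⟩
  | succ m ih =>
    obtain ⟨w, i, rfl⟩ := S.mem_V.1 hx
    obtain ⟨l, w, rfl⟩ := S.exists_consWord w
    obtain ⟨w', j, h⟩ := S.mem_V.1 (ih (S.mem_V.2 ⟨w, i, rfl⟩))
    exact S.mem_V.2 ⟨S.consWord l w', j, by rw [Fw_consWord, Fw_consWord, h]⟩

lemma V_mono : Monotone S.V := monotone_nat_of_le_succ S.V_subset_succ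

lemma q_mem_V (m : ℕ) (i : Fin 3) : S.q i ∈ S.V m :=
  S.V_mono (Nat.zero_le m) (S.mem_V_zero.2 ⟨i, rfl⟩)

/-- By `q_simple` the first letter must be that of `q_l`, and `F_l q_l = q_l` allows it to be
stripped off. Hence a boundary point is a corner of exactly one cell of each level. -/
lemma Fw_eq_q {m : ℕ} {w : S.Word m} {i l : Fin 3} (h : S.Fw w (S.q i) = S.q l) :
    w = (fun _ => S.letter l) ∧ i = l := by
  induction m with
  | zero => exact ⟨Subsingleton.elim _ _, S.q_injective h⟩
  | succ m ih =>
    obtain ⟨l', w, rfl⟩ := S.exists_consWord w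
    rw [Fw_consWord] at h
    have hl : l' = S.letter l := S.q_simple l' l ⟨_, h⟩
    subst hl
    obtain ⟨h1, h2⟩ := ih (S.injective _ (h.trans (S.F_letter_q l).symm))
    refine ⟨?_, h2⟩
    rw [h1]
    funext k
    refine Fin.cases ?_ (fun k => ?_) k <;> simp [consWord]

/-- Continuous functions agreeing on `V_*` are equal. -/
lemma eq_of_eqOn_vertices [CompactSpace K] {f g : K → ℝ} (hf : Continuous f) (hg : Continuous g)
    (h : ∀ (m : ℕ) (w : S.Word m) (i : Fin 3), f (S.Fw w (S.q i)) = g (S.Fw w (S.q i))) :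
    f = g := by
  have hd : Dense {x : K | f x = g x} := by
    rw [Metric.dense_iff]
    intro x δ hδ
    obtain ⟨M, hM⟩ := S.exists_forall_dist_Fw_lt hδ
    obtain ⟨w, y, rfl⟩ := S.exists_Fw_eq M x
    exact ⟨S.Fw w (S.q 0), Metric.mem_ball.2 (hM M le_rfl w _ _), h M w 0⟩
  funext x
  have := (isClosed_eq hf hg).closure_eq
  have hx : x ∈ closure {x : K | f x = g x} := by rw [hd.closure_eq]; trivial
  rwa [this] at hx

lemma nontrivial {K : Type*} [MetricSpace K] [MeasurableSpace K] (S : AnalyticTriangle K) :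
    Nontrivial K :=
  ⟨S.q 0, S.q 1, fun h => by simpa using S.q_injective h⟩

/-- Continuous functions agreeing on `V_* \ V₀` are equal. -/
lemma eq_of_eqOn_vertices_diff [CompactSpace K] [ConnectedSpace K] {f g : K → ℝ}
    (hf : Continuous f) (hg : Continuous g)
    (h : ∀ (m : ℕ), ∀ x ∈ S.V m, x ∉ S.V 0 → f x = g x) : f = g := by
  have := S.nontrivial
  have hd : Dense {x : K | ∃ m, x ∈ S.V m} := by
    rw [Metric.dense_iff]
    intro x δ hδ
    obtain ⟨M, hM⟩ := S.exists_forall_dist_Fw_lt hδ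
    obtain ⟨w, y, rfl⟩ := S.exists_Fw_eq M x
    exact ⟨S.Fw w (S.q 0), Metric.mem_ball.2 (hM M le_rfl w _ _), M, S.mem_V.2 ⟨w, 0, rfl⟩⟩
  -- A nontrivial connected metric space has no isolated points, so removing the finite set `V₀`
  -- preserves density.
  have hd' : Dense ({x : K | ∃ m, x ∈ S.V m} \ (S.V 0 : Set K)) :=
    hd.sdiff_finset _
  have hd'' : Dense {x : K | f x = g x} := hd'.mono (by
    rintro x ⟨⟨m, hm⟩, h0⟩
    exact h m x hm (by simpa using h0))
  funext x
  have := (isClosed_eq hf hg).closure_eq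
  have hx : x ∈ closure {x : K | f x = g x} := by rw [hd''.closure_eq]; trivial
  rwa [this] at hx

end Words

/-! ### Gluing along vertices and self-similar functional equations -/

section Glue

variable {K : Type*} [MetricSpace K] [MeasurableSpace K] (S : AnalyticTriangle K)

lemma eq_q_of_F_eq {l l' : Fin S.N} {y y' : K} (hl : l ≠ l') (h : S.F l y = S.F l' y') :
    ∃ i j, y = S.q i ∧ y' = S.q j := by
  have hw : (fun _ : Fin 1 => l) ≠ (fun _ => l') := fun e => hl (congrFun e 0)
  have key := S.inter_subset 1 (fun _ => l) (fun _ => l') hw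
    (a := S.F l y) ⟨⟨y, rfl⟩, ⟨y', h.symm⟩⟩
  obtain ⟨⟨_, ⟨i, rfl⟩, hi⟩, ⟨_, ⟨j, rfl⟩, hj⟩⟩ := key
  refine ⟨i, j, ?_, ?_⟩
  · exact (S.injective l hi).symm
  · exact (S.injective l' (h ▸ hj)).symm

/-- Continuous functions on the cells of level one which are compatible at the vertices can be
glued to a continuous function on `K`. -/
theorem exists_glue [CompactSpace K] (f : Fin S.N → C(K, ℝ))
    (hc : ∀ l l' i j, S.F l (S.q i) = S.F l' (S.q j) → f l (S.q i) = f l' (S.q j)) :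
    ∃ g : C(K, ℝ), ∀ l y, g (S.F l y) = f l y := by
  have hwd : ∀ l l' y y', S.F l y = S.F l' y' → f l y = f l' y' := by
    intro l l' y y' h
    by_cases hl : l = l'
    · subst hl; rw [S.injective l h]
    · obtain ⟨i, j, rfl, rfl⟩ := S.eq_q_of_F_eq hl h
      exact hc l l' i j h
  choose L Y hLY using S.cover
  let π : (Σ _ : Fin S.N, K) → K := fun p => S.F p.1 p.2
  have hπ : Continuous π := continuous_sigma fun l => S.F_continuous l
  -- A continuous surjection from a compact disjoint union of copies of `K` is closed, hence a
  -- quotient map, so continuity can be checked cell by cell.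
  have hq : IsQuotientMap π := hπ.isClosedMap.isQuotientMap hπ
    (fun x => ⟨⟨L x, Y x⟩, hLY x⟩)
  have hg : ∀ l y, f (L (S.F l y)) (Y (S.F l y)) = f l y := fun l y => hwd _ _ _ _ (hLY _)
  refine ⟨⟨fun x => f (L x) (Y x), ?_⟩, hg⟩
  rw [hq.continuous_iff]
  refine continuous_sigma fun l => ?_
  have : ((fun x => f (L x) (Y x)) ∘ π) ∘ Sigma.mk l = f l := funext fun y => hg l y
  exact (show Continuous (((fun x => f (L x) (Y x)) ∘ π) ∘ Sigma.mk l) by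
    rw [this]; exact (f l).continuous)

/-- Existence of solutions `U` of the self-similarity equation
`U p ∘ F_l = g p l + c U (σ_l p)`, by iteration. -/
theorem exists_selfSimilar [CompactSpace K] {P : Type*} (σ : Fin S.N → P → P)
    (g : P → Fin S.N → C(K, ℝ))
    (c θ : ℝ) (b : P → Fin 3 → ℝ) (U₀ : P → C(K, ℝ)) (size : P → ℝ)
    (hb : ∀ p i, U₀ p (S.q i) = b p i)
    (hcompat : ∀ p l l' i j, S.F l (S.q i) = S.F l' (S.q j) →
      g p l (S.q i) + c * b (σ l p) i = g p l' (S.q j) + c * b (σ l' p) j)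
    (hfix : ∀ p i, g p (S.letter i) (S.q i) + c * b (σ (S.letter i) p) i = b p i)
    (h0 : ∀ p l y, |g p l y + c * U₀ (σ l p) y - U₀ p (S.F l y)| ≤ size p)
    (hsize : ∀ p l, |c| * size (σ l p) ≤ θ * size p) (hθ0 : 0 ≤ θ) (hθ1 : θ < 1) :
    ∃ U : P → C(K, ℝ), (∀ p i, U p (S.q i) = b p i) ∧
      ∀ p l y, U p (S.F l y) = g p l y + c * U (σ l p) y := by
  -- Iterating only among families with boundary values `b` keeps the pieces compatible at shared
  -- vertices at every stage.
  have step : ∀ U : {U : P → C(K, ℝ) // ∀ p i, U p (S.q i) = b p i},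
      ∃ U' : {U : P → C(K, ℝ) // ∀ p i, U p (S.q i) = b p i},
        ∀ p l y, U'.1 p (S.F l y) = g p l y + c * U.1 (σ l p) y := by
    rintro ⟨U, hU⟩
    have : ∀ p, ∃ V : C(K, ℝ), ∀ l y, V (S.F l y) = g p l y + c * U (σ l p) y := by
      intro p
      obtain ⟨V, hV⟩ := S.exists_glue (fun l => g p l + c • U (σ l p)) (by
        intro l l' i j h
        simpa [hU] using hcompat p l l' i j h)
      exact ⟨V, fun l y => by simpa using hV l y⟩
    choose V hV using this
    refine ⟨⟨V, fun p i => ?_⟩, hV⟩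
    have := hV p (S.letter i) (S.q i)
    rw [F_letter_q, hU, hfix] at this
    exact this
  choose Φ hΦ using step
  let U : ℕ → {U : P → C(K, ℝ) // ∀ p i, U p (S.q i) = b p i} := fun n => Φ^[n] ⟨U₀, hb⟩
  have hUs : ∀ n, U (n + 1) = Φ (U n) := fun n => Function.iterate_succ_apply' _ _ _
  -- The bound is weighted by `size p`: `hsize` trades each passage to `σ l p` for a factor `θ`, so
  -- no uniformity in `p` is needed.
  have hd : ∀ n p x, |(U (n + 1)).1 p x - (U n).1 p x| ≤ size p * θ ^ n := by
    intro n
    induction n with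
    | zero =>
      intro p x
      obtain ⟨l, y, rfl⟩ := S.cover x
      rw [hUs, hΦ, pow_zero, mul_one]
      exact h0 p l y
    | succ n ih =>
      intro p x
      obtain ⟨l, y, rfl⟩ := S.cover x
      rw [hUs (n + 1), hΦ]
      conv_lhs => rw [hUs n, hΦ, ← hUs n]
      rw [show g p l y + c * (U (n + 1)).1 (σ l p) y - (g p l y + c * (U n).1 (σ l p) y)
        = c * ((U (n + 1)).1 (σ l p) y - (U n).1 (σ l p) y) by ring, abs_mul]
      calc |c| * |(U (n + 1)).1 (σ l p) y - (U n).1 (σ l p) y|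
          ≤ |c| * (size (σ l p) * θ ^ n) := mul_le_mul_of_nonneg_left (ih _ _) (abs_nonneg c)
        _ = |c| * size (σ l p) * θ ^ n := by ring
        _ ≤ θ * size p * θ ^ n := mul_le_mul_of_nonneg_right (hsize p l) (pow_nonneg hθ0 n)
        _ = size p * θ ^ (n + 1) := by ring
  have hs : ∀ p, 0 ≤ size p := fun p =>
    (abs_nonneg _).trans (h0 p (S.letter 0) (S.q 0))
  have hC : ∀ p, ∃ V : C(K, ℝ), Tendsto (fun n => (U n).1 p) atTop (𝓝 V) := by
    intro p
    refine cauchySeq_tendsto_of_complete (cauchySeq_of_le_geometric θ (size p) hθ1 fun n => ?_)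
    rw [dist_comm, ContinuousMap.dist_le (mul_nonneg (hs p) (pow_nonneg hθ0 n))]
    intro x
    rw [Real.dist_eq]
    exact hd n p x
  choose V hV using hC
  have hVx : ∀ p x, Tendsto (fun n => (U n).1 p x) atTop (𝓝 (V p x)) := fun p x =>
    ((continuous_eval_const x).tendsto (V p)).comp (hV p)
  refine ⟨V, fun p i => ?_, fun p l y => ?_⟩
  · refine tendsto_nhds_unique (hVx p (S.q i)) ?_
    simp only [(U _).2 p i, tendsto_const_nhds]
  · refine tendsto_nhds_unique ((tendsto_add_atTop_iff_nat 1).2 (hVx p (S.F l y))) ?_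
    have : (fun n => (U (n + 1)).1 p (S.F l y)) =
        fun n => g p l y + c * (U n).1 (σ l p) y := by
      funext n; rw [hUs, hΦ]
    rw [this]
    exact ((hVx _ y).const_mul c).const_add _

end Glue

/-! ### Graph energies and harmonic extension from `V₀` to `V₁` -/

section Energy

/-- The bilinear form of `triangleEnergy`. -/
def triB : (Fin 3 → ℝ) →ₗ[ℝ] (Fin 3 → ℝ) →ₗ[ℝ] ℝ :=
  LinearMap.mk₂ ℝ (fun u v => (u 0 - u 1) * (v 0 - v 1) + (u 0 - u 2) * (v 0 - v 2)
      + (u 1 - u 2) * (v 1 - v 2))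
    (by intros; simp; ring) (by intros; simp; ring) (by intros; simp; ring) (by intros; simp; ring)

lemma triB_apply (u v : Fin 3 → ℝ) : triB u v =
    (u 0 - u 1) * (v 0 - v 1) + (u 0 - u 2) * (v 0 - v 2) + (u 1 - u 2) * (v 1 - v 2) := rfl

lemma triB_self (u : Fin 3 → ℝ) : triB u u = triangleEnergy u := by
  simp [triB_apply, triangleEnergy, Fin.sum_univ_three]
  ring

lemma triB_comm (u v : Fin 3 → ℝ) : triB u v = triB v u := by
  simp only [triB_apply]; ring

lemma triB_self_nonneg (u : Fin 3 → ℝ) : 0 ≤ triB u u := by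
  rw [triB_apply]
  exact add_nonneg (add_nonneg (mul_self_nonneg _) (mul_self_nonneg _)) (mul_self_nonneg _)

lemma abs_sub_le_sqrt_triB (u : Fin 3 → ℝ) (i j : Fin 3) : |u i - u j| ≤ √(triB u u) := by
  apply Real.abs_le_sqrt
  rw [triB_apply]
  fin_cases i <;> fin_cases j <;> simp <;>
    nlinarith [sq_nonneg (u 0 - u 1), sq_nonneg (u 0 - u 2), sq_nonneg (u 1 - u 2)]

lemma eq_of_triB_self_eq_zero {u : Fin 3 → ℝ} (h : triB u u = 0) (i j : Fin 3) : u i = u j := by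
  have := abs_sub_le_sqrt_triB u i j
  rw [h, Real.sqrt_zero] at this
  exact sub_eq_zero.1 (abs_eq_zero.1 (le_antisymm this (abs_nonneg _)))

/-- The difference `2 u_l - u_{l+1} - u_{l-1}`. -/
def flux (l : Fin 3) : (Fin 3 → ℝ) →ₗ[ℝ] ℝ := triB.flip (Pi.single l 1)

lemma flux_apply (l : Fin 3) (u : Fin 3 → ℝ) : flux l u = 2 * u l - u (l + 1) - u (l - 1) := by
  have h : (-1 : Fin 3) = 2 := rfl
  fin_cases l <;> simp [flux, triB_apply, h] <;> ring

lemma triB_single (u : Fin 3 → ℝ) (l : Fin 3) : triB u (Pi.single l 1) = flux l u := rfl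

lemma triB_const_right (u : Fin 3 → ℝ) (c : ℝ) : triB u (fun _ => c) = 0 := by
  simp [triB_apply]

variable {K : Type*} [MetricSpace K] [MeasurableSpace K] (S : AnalyticTriangle K)

/-- The restriction of a function to the boundary. -/
def bd : (K → ℝ) →ₗ[ℝ] (Fin 3 → ℝ) := LinearMap.funLeft ℝ ℝ S.q

lemma bd_apply (f : K → ℝ) (i : Fin 3) : S.bd f i = f (S.q i) := rfl

/-- The bilinear form of the graph energy `𝓔_m`. -/
def energyB (m : ℕ) : (K → ℝ) →ₗ[ℝ] (K → ℝ) →ₗ[ℝ] ℝ :=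
  ∑ w : S.Word m, (S.rw w)⁻¹ •
    triB.compl₁₂ (S.bd ∘ₗ LinearMap.funLeft ℝ ℝ (S.Fw w)) (S.bd ∘ₗ LinearMap.funLeft ℝ ℝ (S.Fw w))

lemma energyB_apply (m : ℕ) (f g : K → ℝ) : S.energyB m f g =
    ∑ w : S.Word m, (S.rw w)⁻¹ * triB (S.bd (f ∘ S.Fw w)) (S.bd (g ∘ S.Fw w)) := by
  simp only [energyB, LinearMap.sum_apply, LinearMap.smul_apply, smul_eq_mul,
    LinearMap.compl₁₂_apply]
  rfl

lemma energy_eq (m : ℕ) (f : K → ℝ) : S.energy m f = S.energyB m f f := by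
  simp only [energy, energyB_apply, triB_self]; rfl

lemma energyB_zero (f g : K → ℝ) : S.energyB 0 f g = triB (S.bd f) (S.bd g) := by
  rw [energyB_apply, sum_word_zero]; simp [rw, Fw_zero]

lemma energyB_succ (m : ℕ) (f g : K → ℝ) : S.energyB (m + 1) f g =
    ∑ l, (S.r l)⁻¹ * S.energyB m (f ∘ S.F l) (g ∘ S.F l) := by
  rw [energyB_apply, sum_word_succ]
  refine Finset.sum_congr rfl fun l _ => ?_
  rw [energyB_apply, Finset.mul_sum]
  refine Finset.sum_congr rfl fun w _ => ?_
  rw [comp_Fw_consWord, comp_Fw_consWord, rw_consWord, mul_inv, mul_assoc]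

lemma energyB_one (f g : K → ℝ) : S.energyB 1 f g =
    ∑ l, (S.r l)⁻¹ * triB (S.bd (f ∘ S.F l)) (S.bd (g ∘ S.F l)) := by
  simp only [energyB_succ, energyB_zero]

lemma energyB_comm (m : ℕ) (f g : K → ℝ) : S.energyB m f g = S.energyB m g f := by
  simp only [energyB_apply]
  exact Finset.sum_congr rfl fun w _ => by rw [triB_comm]

lemma energyB_self_nonneg (m : ℕ) (f : K → ℝ) : 0 ≤ S.energyB m f f := by
  rw [energyB_apply]
  exact Finset.sum_nonneg fun w _ => mul_nonneg (inv_nonneg.2 (S.rw_pos w).le) (triB_self_nonneg _)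

lemma energyB_congr {m : ℕ} {f f' g g' : K → ℝ} (hf : ∀ x ∈ S.V m, f x = f' x)
    (hg : ∀ x ∈ S.V m, g x = g' x) : S.energyB m f g = S.energyB m f' g' := by
  simp only [energyB_apply]
  refine Finset.sum_congr rfl fun w _ => ?_
  have h1 : S.bd (f ∘ S.Fw w) = S.bd (f' ∘ S.Fw w) :=
    funext fun i => hf _ (S.mem_V.2 ⟨w, i, rfl⟩)
  have h2 : S.bd (g ∘ S.Fw w) = S.bd (g' ∘ S.Fw w) :=
    funext fun i => hg _ (S.mem_V.2 ⟨w, i, rfl⟩)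
  rw [h1, h2]

lemma energyB_const_right (m : ℕ) (f : K → ℝ) (c : ℝ) : S.energyB m f (fun _ => c) = 0 := by
  rw [energyB_apply]
  exact Finset.sum_eq_zero fun w _ => by
    rw [show S.bd ((fun _ => c) ∘ S.Fw w) = fun _ => c from rfl, triB_const_right, mul_zero]

/-- A function vanishing on the boundary with zero energy of level one vanishes on `V₁`. -/
lemma eq_zero_of_energyB_one [CompactSpace K] [ConnectedSpace K] {f : K → ℝ} (h0 : S.bd f = 0)
    (hE : S.energyB 1 f f = 0) (l : Fin S.N) (i : Fin 3) : f (S.F l (S.q i)) = 0 := by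
  rw [energyB_one, Finset.sum_eq_zero_iff_of_nonneg
    (fun l _ => mul_nonneg (inv_nonneg.2 (S.r_pos l).le) (triB_self_nonneg _))] at hE
  have hc : ∀ l i, f (S.F l (S.q i)) = f (S.F l (S.q 0)) := by
    intro l i
    have := hE l (Finset.mem_univ l)
    rw [mul_eq_zero, inv_eq_zero] at this
    exact eq_of_triB_self_eq_zero (this.resolve_left (S.r_pos l).ne') i 0
  -- Zero energy makes `f` constant on the corners of each cell. These constants glue to a
  -- continuous function with finite range on the connected space `K`, which is therefore constant.
  obtain ⟨g, hg⟩ := S.exists_glue (fun l => ContinuousMap.const K (f (S.F l (S.q 0)))) (by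
    intro l l' i j h
    simp only [ContinuousMap.const_apply]
    rw [← hc l i, ← hc l' j, h])
  have hfin : (Set.range g).Countable := by
    refine ((Set.finite_range fun l => f (S.F l (S.q 0))).subset ?_).countable
    rintro _ ⟨x, rfl⟩
    obtain ⟨l, y, rfl⟩ := S.cover x
    exact ⟨l, (hg l y).symm⟩
  have hsub : (Set.range g).Subsingleton :=
    hfin.isTotallyDisconnected _ subset_rfl (isPreconnected_range g.continuous)
  have h1 : f (S.F l (S.q i)) = g (S.F l (S.q i)) := by rw [hg, hc]; rfl
  have h2 : f (S.q 0) = g (S.q 0) := by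
    conv_rhs => rw [← S.F_letter_q 0, hg, ContinuousMap.const_apply]
    rw [F_letter_q]
  rw [h1, hsub ⟨S.F l (S.q i), rfl⟩ ⟨S.q 0, rfl⟩, ← h2]
  exact congrFun h0 0

/-- Harmonic extension from `V₀` to `V₁`, as a linear map. -/
theorem exists_extension_one [CompactSpace K] [ConnectedSpace K] :
    ∃ Φ : (Fin 3 → ℝ) →ₗ[ℝ] (K → ℝ), (∀ u, S.bd (Φ u) = u) ∧
      ∀ u v, S.energyB 1 (Φ u) v = triB u (S.bd v) := by
  have henergy : ∀ f : K → ℝ,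
      ∑ l, (S.r l)⁻¹ * triangleEnergy (fun i => f (S.F l (S.q i))) = S.energyB 1 f f := by
    intro f
    rw [energyB_one]
    exact Finset.sum_congr rfl fun l _ => by rw [triB_self]; rfl
  have hmin : ∀ u, ∃ f : K → ℝ, S.bd f = u ∧ S.energyB 1 f f = triB u u := by
    intro u
    obtain ⟨⟨f, hf, he⟩, -⟩ := S.harmonic_structure u
    exact ⟨f, funext hf, by rw [← henergy, ← he, triB_self]⟩
  have hle : ∀ f : K → ℝ, triB (S.bd f) (S.bd f) ≤ S.energyB 1 f f := by
    intro f
    obtain ⟨-, h⟩ := S.harmonic_structure (S.bd f)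
    rw [triB_self, ← henergy]
    exact h ⟨f, fun _ => rfl, rfl⟩
  have horth : ∀ (f : K → ℝ), S.energyB 1 f f = triB (S.bd f) (S.bd f) →
      ∀ v, S.bd v = 0 → S.energyB 1 f v = 0 := by
    intro f hf v hv
    -- Minimality along the line `f + t v`: a nonnegative quadratic in `t` without constant term has
    -- no linear term either.
    have key : ∀ t : ℝ, 0 ≤ S.energyB 1 v v * (t * t) + 2 * S.energyB 1 f v * t + 0 := by
      intro t
      have h := hle (f + t • v)
      rw [map_add S.bd, map_smul S.bd, hv, smul_zero, add_zero, ← hf] at h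
      simp only [map_add, map_smul, LinearMap.add_apply, LinearMap.smul_apply, smul_eq_mul] at h
      rw [S.energyB_comm 1 v f] at h
      linarith
    have := discrim_le_zero key
    rw [discrim] at this
    nlinarith [sq_nonneg (S.energyB 1 f v)]
  choose φ hφ hφE using hmin
  -- The chosen minimizers are arbitrary off `V₁` and need not depend linearly on `u`. Combining the
  -- three basis minimizers restores linearity, and orthogonality to functions vanishing on `V₀`
  -- survives linear combination.
  let Φ : (Fin 3 → ℝ) →ₗ[ℝ] (K → ℝ) :=
    ∑ i, (LinearMap.proj i : (Fin 3 → ℝ) →ₗ[ℝ] ℝ).smulRight (φ (Pi.single i 1))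
  have hΦ : ∀ u, Φ u = ∑ i, u i • φ (Pi.single i 1) := fun u => by simp [Φ]
  have hbd : ∀ u, S.bd (Φ u) = u := by
    intro u
    rw [hΦ, map_sum]
    simp only [map_smul, hφ]
    funext j
    simp [Finset.sum_apply, Pi.single_apply]
  have ho : ∀ u v, S.bd v = 0 → S.energyB 1 (Φ u) v = 0 := by
    intro u v hv
    rw [hΦ, map_sum, LinearMap.sum_apply]
    refine Finset.sum_eq_zero fun i _ => ?_
    rw [map_smul, LinearMap.smul_apply, horth _ (by rw [hφE, hφ]) v hv, smul_zero]
  have hE : ∀ u, S.energyB 1 (Φ u) (Φ u) = triB u u := by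
    intro u
    have hd : S.bd (Φ u - φ u) = 0 := by rw [map_sub, hbd, hφ, sub_self]
    have h1 := ho u _ hd
    have h2 := horth (φ u) (by rw [hφE, hφ]) _ hd
    rw [map_sub] at h1 h2
    rw [← hφE u]
    rw [S.energyB_comm 1 (φ u) (Φ u)] at h2
    linarith
  refine ⟨Φ, hbd, fun u v => ?_⟩
  have h1 := ho u (v - Φ (S.bd v)) (by rw [map_sub, hbd, sub_self])
  rw [map_sub, sub_eq_zero] at h1
  rw [h1]
  have h2 := hE (u + S.bd v)
  have h3 := hE u
  have h4 := hE (S.bd v)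
  simp only [map_add, LinearMap.add_apply] at h2
  rw [S.energyB_comm 1 (Φ (S.bd v)) (Φ u), triB_comm (S.bd v) u] at h2
  linarith

end Energy

/-! ### Harmonic functions on `K` -/

section Harmonic

variable {K : Type*} [MetricSpace K] [MeasurableSpace K] [CompactSpace K] [ConnectedSpace K]
  (S : AnalyticTriangle K)

omit [CompactSpace K] [ConnectedSpace K] in
lemma exists_boundary_bump (i : Fin 3) : ∃ χ : C(K, ℝ), (∀ x, |χ x| ≤ 1) ∧
    ∀ j, χ (S.q j) = (Pi.single i 1 : Fin 3 → ℝ) j := by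
  obtain ⟨χ, h0, h1, h⟩ := exists_continuous_zero_one_of_isClosed
    (s := S.q '' {i}ᶜ) (t := {S.q i})
    ((Set.toFinite _).isClosed) isClosed_singleton (by
      rw [Set.disjoint_singleton_right]
      rintro ⟨j, hj, he⟩
      exact hj (S.q_injective he))
  refine ⟨χ, fun x => ?_, fun j => ?_⟩
  · rw [abs_of_nonneg (h x).1]; exact (h x).2
  · by_cases hj : j = i
    · subst hj; simpa using h1 rfl
    · rw [Pi.single_eq_of_ne hj]; exact h0 ⟨j, hj, rfl⟩

theorem exists_harmonic_extension : ∃ H : (Fin 3 → ℝ) →ₗ[ℝ] C(K, ℝ),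
    (∀ u i, H u (S.q i) = u i) ∧
    (∀ u l y, H u (S.F l y) = H (S.bd (H u ∘ S.F l)) y) ∧
    ∀ u v, S.energyB 1 (H u) v = triB u (S.bd v) := by
  obtain ⟨Φ, hΦ, hE⟩ := S.exists_extension_one
  let A : Fin S.N → (Fin 3 → ℝ) →ₗ[ℝ] (Fin 3 → ℝ) := fun l =>
    S.bd ∘ₗ LinearMap.funLeft ℝ ℝ (S.F l) ∘ₗ Φ
  have hA : ∀ l u i, A l u i = Φ u (S.F l (S.q i)) := fun l u i => rfl
  -- Each cell carries at most the whole energy, so passing to a cell contracts the square root of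
  -- the energy by `√r_l`. This drives the convergence of the fixed-point iteration below.
  have hAE : ∀ l u, triB (A l u) (A l u) ≤ S.r l * triB u u := by
    intro l u
    have h1 : ∑ l, (S.r l)⁻¹ * triB (A l u) (A l u) = triB u u := by
      have := hE u (Φ u)
      rw [hΦ, energyB_one] at this
      exact this
    have h2 := Finset.single_le_sum (f := fun l => (S.r l)⁻¹ * triB (A l u) (A l u))
      (fun l _ => mul_nonneg (inv_nonneg.2 (S.r_pos l).le) (triB_self_nonneg _))
      (Finset.mem_univ l)
    rw [h1] at h2
    rwa [inv_mul_le_iff₀ (S.r_pos l)] at h2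
  have hA1 : ∀ l c, A l (fun _ => c) = fun _ => c := by
    intro l c
    funext i
    have hb : S.bd (Φ (fun _ => c) - fun _ => c) = 0 := by
      rw [map_sub, hΦ]; exact sub_self _
    have := S.eq_zero_of_energyB_one hb (by
      rw [map_sub, energyB_const_right, sub_zero, energyB_comm, hE, hb, map_zero]) l i
    rw [hA]
    exact sub_eq_zero.1 this
  choose χ hχ hχq using S.exists_boundary_bump
  let U₀ : (Fin 3 → ℝ) → C(K, ℝ) := fun u =>
    ContinuousMap.const K (u 0) + (u 1 - u 0) • χ 1 + (u 2 - u 0) • χ 2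
  obtain ⟨θ, hθ0, hθ1, hθ⟩ : ∃ θ : ℝ, 0 ≤ θ ∧ θ < 1 ∧ ∀ l, √(S.r l) ≤ θ := by
    have hN : (Finset.univ : Finset (Fin S.N)).Nonempty := ⟨S.letter 0, Finset.mem_univ _⟩
    refine ⟨Finset.univ.sup' hN fun l => √(S.r l), ?_, ?_, fun l =>
      Finset.le_sup' (fun l => √(S.r l)) (Finset.mem_univ l)⟩
    · exact (Real.sqrt_nonneg _).trans
        (Finset.le_sup' (fun l => √(S.r l)) (Finset.mem_univ (S.letter 0)))
    · rw [Finset.sup'_lt_iff]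
      intro l _
      rw [Real.sqrt_lt' one_pos, one_pow]; exact S.r_lt_one l
  let C₀ : ℝ := ∑ l, ∑ i, |A l (Pi.single i 1) 0|
  have hC₀ : ∀ l u, |A l u 0 - u 0| ≤ C₀ * √(triB u u) := by
    intro l u
    have h1 : A l u 0 - u 0 = A l (u - fun _ => u 0) 0 := by
      rw [map_sub, hA1]; rfl
    have h2 : A l (u - fun _ => u 0) = ∑ i, (u i - u 0) • A l (Pi.single i 1) := by
      conv_lhs => rw [pi_eq_sum_univ' (u - fun _ => u 0), map_sum]
      refine Finset.sum_congr rfl fun i _ => ?_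
      rw [map_smul]; congr 2
    rw [h1, h2, Finset.sum_apply]
    calc |∑ i, ((u i - u 0) • A l (Pi.single i 1)) 0|
        ≤ ∑ i, |((u i - u 0) • A l (Pi.single i 1)) 0| := Finset.abs_sum_le_sum_abs _ _
      _ ≤ ∑ i, √(triB u u) * |A l (Pi.single i 1) 0| := by
          refine Finset.sum_le_sum fun i _ => ?_
          rw [Pi.smul_apply, smul_eq_mul, abs_mul]
          exact mul_le_mul_of_nonneg_right (abs_sub_le_sqrt_triB u i 0) (abs_nonneg _)
      _ = (∑ i, |A l (Pi.single i 1) 0|) * √(triB u u) := by rw [← Finset.mul_sum, mul_comm]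
      _ ≤ C₀ * √(triB u u) := by
          refine mul_le_mul_of_nonneg_right ?_ (Real.sqrt_nonneg _)
          exact Finset.single_le_sum (f := fun l => ∑ i, |A l (Pi.single i 1) 0|)
            (fun l _ => Finset.sum_nonneg fun i _ => abs_nonneg _) (Finset.mem_univ l)
  have hsA : ∀ l u, √(triB (A l u) (A l u)) ≤ θ * √(triB u u) := by
    intro l u
    refine (Real.sqrt_le_sqrt (hAE l u)).trans ?_
    rw [Real.sqrt_mul (S.r_pos l).le]
    exact mul_le_mul_of_nonneg_right (hθ l) (Real.sqrt_nonneg _)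
  have hterm : ∀ (u : Fin 3 → ℝ) (i : Fin 3) (x : K),
      |(u i - u 0) * χ i x| ≤ √(triB u u) := by
    intro u i x
    rw [abs_mul]
    exact (mul_le_mul (abs_sub_le_sqrt_triB u i 0) (hχ i x) (abs_nonneg _)
      (Real.sqrt_nonneg _)).trans (mul_one _).le
  -- In the initial error, `C₀` bounds the change of the base value `u 0`, and `4` counts the bump
  -- terms: two for `A l u` and two for `u`.
  obtain ⟨U, hUq, hUF⟩ := S.exists_selfSimilar (fun l u => A l u) (fun _ _ => 0) 1 θ
    (fun u i => u i) U₀ (fun u => (C₀ + 4) * √(triB u u))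
    (by
      intro u i
      fin_cases i <;> simp [U₀, hχq])
    (by
      intro u l l' i j h
      simp only [hA, h, ContinuousMap.zero_apply])
    (by
      intro u i
      simp only [hA, F_letter_q, ContinuousMap.zero_apply, zero_add, one_mul]
      exact congrFun (hΦ u) i)
    (by
      intro u l y
      simp only [U₀, ContinuousMap.zero_apply, zero_add, one_mul, ContinuousMap.add_apply,
        ContinuousMap.const_apply, ContinuousMap.smul_apply, smul_eq_mul]
      have hs : √(triB (A l u) (A l u)) ≤ √(triB u u) :=
        (hsA l u).trans (mul_le_of_le_one_left (Real.sqrt_nonneg _) hθ1.le)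
      have h1 := abs_le.1 (hC₀ l u)
      have h2 := abs_le.1 ((hterm (A l u) 1 y).trans hs)
      have h3 := abs_le.1 ((hterm (A l u) 2 y).trans hs)
      have h4 := abs_le.1 (hterm u 1 (S.F l y))
      have h5 := abs_le.1 (hterm u 2 (S.F l y))
      rw [abs_le]
      constructor <;> linarith [h1.1, h1.2, h2.1, h2.2, h3.1, h3.2, h4.1, h4.2, h5.1, h5.2])
    (by
      intro u l
      rw [abs_one, one_mul, mul_left_comm]
      refine mul_le_mul_of_nonneg_left (hsA l u) ?_
      have : 0 ≤ C₀ := Finset.sum_nonneg fun l _ => Finset.sum_nonneg fun i _ => abs_nonneg _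
      linarith)
    hθ0 hθ1
  simp only [ContinuousMap.zero_apply, zero_add, one_mul] at hUF
  -- The fixed point was obtained separately for each `u`; linearity is recovered on the vertices,
  -- where the functional equation determines the values, and then extended by density.
  have hUV : ∀ (m : ℕ) (w : S.Word m) (i : Fin 3) (a b : ℝ) (u v : Fin 3 → ℝ),
      U (a • u + b • v) (S.Fw w (S.q i)) =
        a * U u (S.Fw w (S.q i)) + b * U v (S.Fw w (S.q i)) := by
    intro m
    induction m with
    | zero => intro w i a b u v; simp [Fw_zero, hUq]
    | succ m ih =>
      intro w i a b u v
      obtain ⟨l, w, rfl⟩ := S.exists_consWord w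
      simp only [Fw_consWord, hUF, map_add, map_smul, ih]
  have hlin : ∀ (a b : ℝ) (u v : Fin 3 → ℝ) x, U (a • u + b • v) x = a * U u x + b * U v x := by
    intro a b u v
    refine congrFun (S.eq_of_eqOn_vertices (U _).continuous ?_ fun m w i => hUV m w i a b u v)
    fun_prop
  let H : (Fin 3 → ℝ) →ₗ[ℝ] C(K, ℝ) :=
    { toFun := U
      map_add' := fun u v => ContinuousMap.ext fun x => by simpa using hlin 1 1 u v x
      map_smul' := fun a u => ContinuousMap.ext fun x => by simpa using hlin a 0 u 0 x }
  have hHA : ∀ u l, S.bd (H u ∘ S.F l) = A l u := by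
    intro u l
    funext i
    exact (hUF u l (S.q i)).trans (hUq _ i)
  refine ⟨H, hUq, fun u l y => ?_, fun u v => ?_⟩
  · rw [hHA]; exact hUF u l y
  · rw [← hE u v, energyB_one, energyB_one]
    exact Finset.sum_congr rfl fun l _ => by rw [hHA]; rfl

/-- The harmonic function with given boundary values. -/
def harm : (Fin 3 → ℝ) →ₗ[ℝ] C(K, ℝ) := S.exists_harmonic_extension.choose

lemma harm_q (u : Fin 3 → ℝ) (i : Fin 3) : S.harm u (S.q i) = u i :=
  S.exists_harmonic_extension.choose_spec.1 u i

lemma bd_harm (u : Fin 3 → ℝ) : S.bd (S.harm u) = u := funext (S.harm_q u)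

lemma harm_comp_F (u : Fin 3 → ℝ) (l : Fin S.N) :
    S.harm u ∘ S.F l = S.harm (S.bd (S.harm u ∘ S.F l)) :=
  funext (S.exists_harmonic_extension.choose_spec.2.1 u l)

lemma energyB_one_harm (u : Fin 3 → ℝ) (v : K → ℝ) :
    S.energyB 1 (S.harm u) v = triB u (S.bd v) :=
  S.exists_harmonic_extension.choose_spec.2.2 u v

lemma energyB_harm (m : ℕ) (u : Fin 3 → ℝ) (v : K → ℝ) :
    S.energyB m (S.harm u) v = triB u (S.bd v) := by
  induction m generalizing u v with
  | zero => rw [energyB_zero, bd_harm]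
  | succ m ih =>
    rw [← energyB_one_harm, energyB_succ, energyB_one]
    refine Finset.sum_congr rfl fun l _ => ?_
    conv_lhs => rw [harm_comp_F, ih]

lemma harm_const (c : ℝ) (x : K) : S.harm (fun _ => c) x = c := by
  refine congrFun (f := S.harm fun _ => c) (g := fun _ => c)
    (S.eq_of_eqOn_vertices (ContinuousMap.continuous _) continuous_const ?_) x
  intro m
  induction m with
  | zero => intro w i; exact S.harm_q _ i
  | succ m ih =>
    intro w i
    obtain ⟨l, w, rfl⟩ := S.exists_consWord w
    have hl : S.bd (S.harm (fun _ => c) ∘ S.F l) = fun _ => c := by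
      funext i
      have hb : S.bd (⇑(S.harm fun _ => c) - fun _ => c) = 0 := by
        rw [map_sub, bd_harm]; exact sub_self _
      exact sub_eq_zero.1 (S.eq_zero_of_energyB_one hb (by
        rw [map_sub, energyB_const_right, sub_zero, energyB_comm, energyB_one_harm, hb,
          map_zero]) l i)
    have := congrFun (S.harm_comp_F (fun _ => c) l) (S.Fw w (S.q i))
    rw [Fw_consWord]
    rw [hl] at this
    exact this.trans (ih w i)

lemma harm_eq_sum (u : Fin 3 → ℝ) (x : K) :
    S.harm u x = ∑ i, u i * S.harm (Pi.single i 1) x := by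
  conv_lhs => rw [pi_eq_sum_univ' u, map_sum]
  rw [ContinuousMap.sum_apply]
  refine Finset.sum_congr rfl fun i _ => ?_
  rw [map_smul, ContinuousMap.smul_apply, smul_eq_mul]

/-- Functions on `V_m` extend to continuous functions which are harmonic on each `m`-cell. -/
lemma exists_piecewise_harm (m : ℕ) (v : K → ℝ) :
    ∃ ψ : C(K, ℝ), ∀ w : S.Word m, ψ ∘ S.Fw w = S.harm (S.bd (v ∘ S.Fw w)) := by
  induction m generalizing v with
  | zero => exact ⟨S.harm (S.bd v), fun w => rfl⟩
  | succ m ih =>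
    choose ψ hψ using fun l => ih (v ∘ S.F l)
    have hV : ∀ l, ∀ x ∈ S.V m, ψ l x = v (S.F l x) := by
      intro l x hx
      obtain ⟨w, i, rfl⟩ := S.mem_V.1 hx
      have := congrFun (hψ l w) (S.q i)
      rw [harm_q] at this
      exact this
    obtain ⟨g, hg⟩ := S.exists_glue ψ (by
      intro l l' i j h
      rw [hV l _ (S.q_mem_V m i), hV l' _ (S.q_mem_V m j), h])
    refine ⟨g, fun w => ?_⟩
    obtain ⟨l, w, rfl⟩ := S.exists_consWord w
    rw [comp_Fw_consWord, comp_Fw_consWord, ← hψ l w]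
    congr 1
    exact funext (hg l)

/-- Pythagoras: pairing with a harmonic function sees only boundary values, so the cross terms
reduce to the boundary energy. -/
lemma energyB_sub_harm (m : ℕ) (f : K → ℝ) :
    S.energyB m (f - S.harm (S.bd f)) (f - S.harm (S.bd f)) =
      S.energyB m f f - triB (S.bd f) (S.bd f) := by
  have h1 := S.energyB_harm m (S.bd f) f
  have h2 := S.energyB_harm m (S.bd f) (S.harm (S.bd f))
  have h3 := S.energyB_comm m f (S.harm (S.bd f))
  rw [bd_harm] at h2
  rw [map_sub, map_sub, LinearMap.sub_apply, LinearMap.sub_apply, h3, h1, h2]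
  ring

lemma energyB_le_succ (m : ℕ) (f : K → ℝ) : S.energyB m f f ≤ S.energyB (m + 1) f f := by
  induction m generalizing f with
  | zero =>
    have h1 := S.energyB_self_nonneg 1 (f - S.harm (S.bd f))
    rw [energyB_sub_harm] at h1
    rw [energyB_zero]
    linarith
  | succ m ih =>
    rw [energyB_succ, S.energyB_succ (m + 1)]
    exact Finset.sum_le_sum fun l _ =>
      mul_le_mul_of_nonneg_left (ih _) (inv_nonneg.2 (S.r_pos l).le)

lemma energyB_zero_le (m : ℕ) (f : K → ℝ) : triB (S.bd f) (S.bd f) ≤ S.energyB m f f := by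
  induction m with
  | zero => rw [energyB_zero]
  | succ m ih => exact ih.trans (S.energyB_le_succ m f)

lemma energyB_piecewise_harm {m : ℕ} {v ψ : K → ℝ}
    (hψ : ∀ w : S.Word m, ψ ∘ S.Fw w = S.harm (S.bd (v ∘ S.Fw w))) :
    S.energyB (m + 1) ψ ψ = S.energyB m v v := by
  induction m generalizing v ψ with
  | zero =>
    have := hψ Fin.elim0
    rw [Fw_zero, Function.comp_id, Function.comp_id] at this
    rw [this, energyB_one_harm, energyB_zero, bd_harm]
  | succ m ih =>
    rw [energyB_succ, S.energyB_succ m]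
    refine Finset.sum_congr rfl fun l _ => ?_
    rw [ih (v := v ∘ S.F l) (ψ := ψ ∘ S.F l) fun w => by
      rw [← comp_Fw_consWord, ← comp_Fw_consWord, hψ]]

/-- Equality at level one forces agreement with the harmonic function on `V₁`. Equality at all
levels passes to each cell, since termwise inequalities with equal sums are termwise equalities. -/
lemma eqOn_harm_of_energyB_eq {f : K → ℝ} (h : ∀ m, S.energyB m f f = triB (S.bd f) (S.bd f))
    (m : ℕ) (w : S.Word m) (i : Fin 3) :
    f (S.Fw w (S.q i)) = S.harm (S.bd f) (S.Fw w (S.q i)) := by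
  induction m generalizing f with
  | zero => exact (S.harm_q (S.bd f) i).symm
  | succ m ih =>
    obtain ⟨l, w, rfl⟩ := S.exists_consWord w
    have hb : S.bd (f - S.harm (S.bd f)) = 0 := by rw [map_sub, bd_harm, sub_self]
    have hz := S.eq_zero_of_energyB_one hb (by
      rw [energyB_sub_harm, h 1, sub_self])
    have hbl : S.bd (S.harm (S.bd f) ∘ S.F l) = S.bd (f ∘ S.F l) :=
      funext fun i => (sub_eq_zero.1 (hz l i)).symm
    have hl : ∀ n l, S.energyB n (f ∘ S.F l) (f ∘ S.F l) =
        triB (S.bd (f ∘ S.F l)) (S.bd (f ∘ S.F l)) := by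
      intro n
      have h1 := h 1
      have h2 := h (n + 1)
      rw [← h1, energyB_succ, energyB_one] at h2
      have h3 := (Finset.sum_eq_sum_iff_of_le fun l _ =>
        mul_le_mul_of_nonneg_left (S.energyB_zero_le n (f ∘ S.F l))
          (inv_nonneg.2 (S.r_pos l).le)).1 h2.symm
      intro l
      exact (mul_left_cancel₀ (inv_ne_zero (S.r_pos l).ne') (h3 l (Finset.mem_univ l))).symm
    have h4 := ih (f := f ∘ S.F l) (fun n => hl n l) w
    rw [Fw_consWord, ← Function.comp_apply (f := f), h4, ← hbl, ← harm_comp_F]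
    rfl

/-- Interpolating `h` harmonically on each `m`-cell adds no energy from level `m` to `m + 1`. A
minimizing `h` therefore has constant energy along the levels, which characterizes the harmonic
extension of its boundary values. -/
theorem isHarmonic_iff {h : K → ℝ} : S.IsHarmonic h ↔ h = S.harm (S.bd h) := by
  constructor
  · rintro ⟨hc, hm⟩
    have hle : ∀ m, S.energyB m h h = triB (S.bd h) (S.bd h) := by
      intro m
      refine le_antisymm ?_ (S.energyB_zero_le m h)
      induction m with
      | zero => rw [energyB_zero]
      | succ m ih =>
        obtain ⟨ψ, hψ⟩ := S.exists_piecewise_harm m h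
        have h1 := hm m ψ (by
          intro x hx
          obtain ⟨w, i, rfl⟩ := S.mem_V.1 hx
          have := congrFun (hψ w) (S.q i)
          rw [harm_q] at this
          exact this)
        rw [energy_eq, energy_eq, S.energyB_piecewise_harm hψ] at h1
        exact h1.trans ih
    exact S.eq_of_eqOn_vertices hc (ContinuousMap.continuous _) (S.eqOn_harm_of_energyB_eq hle)
  · intro hh
    refine ⟨hh ▸ ContinuousMap.continuous _, fun m f hf => ?_⟩
    rw [energy_eq, energy_eq]
    refine le_trans (le_of_eq ?_) (S.energyB_le_succ m f)
    rw [S.energyB_congr hf hf, hh, energyB_harm, energyB_harm]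

lemma isHarmonic_harm (u : Fin 3 → ℝ) : S.IsHarmonic (S.harm u) :=
  S.isHarmonic_iff.2 (by rw [bd_harm])

lemma harmExt_eq (u : Fin 3 → ℝ) : S.harmExt u = S.harm u := by
  have H : ∃ h, S.IsHarmonic h ∧ ∀ i, h (S.q i) = u i := ⟨_, S.isHarmonic_harm u, S.harm_q u⟩
  rw [harmExt, dif_pos H, S.isHarmonic_iff.1 H.choose_spec.1]
  congr 2
  exact funext H.choose_spec.2

/-- The indicator function of a point. -/
def pointInd (x : K) : K → ℝ := Set.indicator {x} 1

omit [MetricSpace K] [MeasurableSpace K] [CompactSpace K] [ConnectedSpace K] in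
lemma pointInd_self (x : K) : pointInd x x = 1 := by simp [pointInd]

omit [MetricSpace K] [MeasurableSpace K] [CompactSpace K] [ConnectedSpace K] in
lemma pointInd_of_ne {x y : K} (h : y ≠ x) : pointInd x y = 0 := by simp [pointInd, h]

lemma tent_comp_Fw {m : ℕ} {x : K} (hx : x ∈ S.V m) (w : S.Word m) :
    S.tent m x ∘ S.Fw w = S.harm (S.bd (pointInd x ∘ S.Fw w)) := by
  have H : ∃ ψ, S.IsTent m x ψ := by
    obtain ⟨ψ, hψ⟩ := S.exists_piecewise_harm m (pointInd x)
    have hV : ∀ y ∈ S.V m, ψ y = pointInd x y := by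
      intro y hy
      obtain ⟨w, i, rfl⟩ := S.mem_V.1 hy
      have := congrFun (hψ w) (S.q i)
      rw [harm_q] at this
      exact this
    refine ⟨ψ, ψ.continuous, fun w => ?_, ?_, fun y hy hyx => ?_⟩
    · rw [hψ]; exact S.isHarmonic_harm _
    · rw [hV x hx, pointInd_self]
    · rw [hV y hy, pointInd_of_ne hyx]
  rw [tent, dif_pos H]
  obtain ⟨-, h1, h2, h3⟩ := H.choose_spec
  rw [S.isHarmonic_iff.1 (h1 w)]
  congr 2
  funext i
  simp only [bd_apply, Function.comp_apply]
  by_cases hi : S.Fw w (S.q i) = x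
  · rw [hi, h2, pointInd_self]
  · rw [h3 _ (S.mem_V.2 ⟨w, i, rfl⟩) hi, pointInd_of_ne hi]

omit [CompactSpace K] [ConnectedSpace K] in
lemma continuous_tent {m : ℕ} {x : K} : Continuous (S.tent m x) := by
  rw [tent]
  split_ifs with H
  · exact H.choose_spec.1
  · exact continuous_zero

end Harmonic

/-! ### Integration against the self-similar measure -/

section Measure

variable {K : Type*} [MetricSpace K] [MeasurableSpace K] (S : AnalyticTriangle K)

instance : IsProbabilityMeasure S.μ := S.μ_prob

lemma integrable_of_continuous [CompactSpace K] [BorelSpace K] {f : K → ℝ} (hf : Continuous f) :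
    Integrable f S.μ :=
  hf.integrable_of_hasCompactSupport (HasCompactSupport.of_compactSpace f)

lemma μ_eq_sum [BorelSpace K] : S.μ = ∑ l, ENNReal.ofReal (S.wt l) • S.μ.map (S.F l) := by
  ext A hA
  rw [S.μ_selfSimilar A hA, Measure.finsetSum_apply]
  refine Finset.sum_congr rfl fun l _ => ?_
  rw [Measure.smul_apply, Measure.map_apply (S.F_continuous l).measurable hA, smul_eq_mul]

lemma integral_eq_sum [CompactSpace K] [BorelSpace K] {f : K → ℝ} (hf : Continuous f) :
    ∫ y, f y ∂S.μ = ∑ l, S.wt l * ∫ y, f (S.F l y) ∂S.μ := by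
  have hm : ∀ l, ∫ y, f y ∂(S.μ.map (S.F l)) = ∫ y, f (S.F l y) ∂S.μ := fun l =>
    integral_map (S.F_continuous l).measurable.aemeasurable hf.aestronglyMeasurable
  have hi : ∀ l, Integrable f (ENNReal.ofReal (S.wt l) • S.μ.map (S.F l)) := by
    intro l
    refine Integrable.smul_measure ?_ ENNReal.ofReal_ne_top
    rw [integrable_map_measure hf.aestronglyMeasurable (S.F_continuous l).measurable.aemeasurable]
    exact S.integrable_of_continuous (hf.comp (S.F_continuous l))
  conv_lhs => rw [μ_eq_sum]
  rw [integral_finsetSum_measure fun l _ => hi l]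
  refine Finset.sum_congr rfl fun l _ => ?_
  rw [integral_smul_measure, hm, ENNReal.toReal_ofReal (S.wt_pos l).le, smul_eq_mul]

lemma integral_eq_sum_word [CompactSpace K] [BorelSpace K] (m : ℕ) {f : K → ℝ}
    (hf : Continuous f) :
    ∫ y, f y ∂S.μ = ∑ w : S.Word m, S.μw w * ∫ y, f (S.Fw w y) ∂S.μ := by
  induction m generalizing f with
  | zero => rw [sum_word_zero]; simp [μw, Fw_zero]
  | succ m ih =>
    rw [sum_word_succ, S.integral_eq_sum hf]
    refine Finset.sum_congr rfl fun l _ => ?_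
    rw [ih (f := fun y => f (S.F l y)) (hf.comp (S.F_continuous l)), Finset.mul_sum]
    refine Finset.sum_congr rfl fun w _ => ?_
    simp only [μw_consWord, Fw_consWord, mul_assoc]

end Measure

/-! ### Integrals against piecewise harmonic functions; the discrete Green formula -/

section Pairing

variable {K : Type*} [MetricSpace K] [MeasurableSpace K] [CompactSpace K] [ConnectedSpace K]
  (S : AnalyticTriangle K)

/-- The integral of `f` against the harmonic function with boundary values `δ_i`. -/
def moment (f : K → ℝ) (i : Fin 3) : ℝ := ∫ y, f y * S.harm (Pi.single i 1) y ∂S.μ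

/-- The integral of `f` against the piecewise harmonic function of level `m` which agrees with
`v` on `V_m`. -/
def pairing (m : ℕ) (f v : K → ℝ) : ℝ :=
  ∑ w : S.Word m, ∑ i, S.μw w * (v (S.Fw w (S.q i)) * S.moment (f ∘ S.Fw w) i)

lemma pairing_zero (f v : K → ℝ) : S.pairing 0 f v = ∑ i, v (S.q i) * S.moment f i := by
  rw [pairing, sum_word_zero]
  simp [μw, Fw_zero]

lemma pairing_succ (m : ℕ) (f v : K → ℝ) :
    S.pairing (m + 1) f v = ∑ l, S.wt l * S.pairing m (f ∘ S.F l) (v ∘ S.F l) := by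
  rw [pairing, sum_word_succ]
  refine Finset.sum_congr rfl fun l _ => ?_
  rw [pairing, Finset.mul_sum]
  refine Finset.sum_congr rfl fun w _ => ?_
  rw [Finset.mul_sum]
  refine Finset.sum_congr rfl fun i _ => ?_
  rw [comp_Fw_consWord, μw_consWord, Fw_consWord, Function.comp_apply]
  ring

lemma pairing_add_right (m : ℕ) (f v v' : K → ℝ) :
    S.pairing m f (v + v') = S.pairing m f v + S.pairing m f v' := by
  simp only [pairing, ← Finset.sum_add_distrib, Pi.add_apply]
  refine Finset.sum_congr rfl fun w _ => Finset.sum_congr rfl fun i _ => by ring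

lemma pairing_smul_right (m : ℕ) (f v : K → ℝ) (a : ℝ) :
    S.pairing m f (a • v) = a * S.pairing m f v := by
  simp only [pairing, Finset.mul_sum, Pi.smul_apply, smul_eq_mul]
  refine Finset.sum_congr rfl fun w _ => Finset.sum_congr rfl fun i _ => by ring

/-- `pairing` as a linear form in its last argument. -/
def pairingₗ (m : ℕ) (f : K → ℝ) : (K → ℝ) →ₗ[ℝ] ℝ where
  toFun := S.pairing m f
  map_add' := S.pairing_add_right m f
  map_smul' a v := S.pairing_smul_right m f v a

lemma pairing_sub_right (m : ℕ) (f v v' : K → ℝ) :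
    S.pairing m f (v - v') = S.pairing m f v - S.pairing m f v' :=
  map_sub (S.pairingₗ m f) v v'

lemma pairing_congr {m : ℕ} {f v v' : K → ℝ} (h : ∀ x ∈ S.V m, v x = v' x) :
    S.pairing m f v = S.pairing m f v' :=
  Finset.sum_congr rfl fun w _ => Finset.sum_congr rfl fun i _ => by
    rw [h _ (S.mem_V.2 ⟨w, i, rfl⟩)]

lemma pairing_pointInd (m : ℕ) (f : K → ℝ) (x : K) : S.pairing m f (pointInd x) =
    ∑ p ∈ S.cellsAt m x, S.μw p.1 * S.moment (f ∘ S.Fw p.1) p.2 := by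
  classical
  rw [pairing, ← Fintype.sum_prod_type', cellsAt, Finset.sum_filter]
  refine Finset.sum_congr rfl fun p _ => ?_
  split_ifs with h
  · rw [h, pointInd_self, one_mul]
  · rw [pointInd_of_ne h, zero_mul, mul_zero]

lemma triB_eq_sum (u v : Fin 3 → ℝ) : triB u v = ∑ i, v i * flux i u := by
  have h : (-1 : Fin 3) = 2 := rfl
  simp [triB_apply, Fin.sum_univ_three, flux_apply, h]
  ring

lemma flux_eq (l : Fin 3) (u : Fin 3 → ℝ) : flux l u = 3 * u l - ∑ i, u i := by
  have h : (-1 : Fin 3) = 2 := rfl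
  fin_cases l <;> simp [flux_apply, Fin.sum_univ_three, h] <;> ring

omit [CompactSpace K] [ConnectedSpace K] in
lemma energyB_pointInd (m : ℕ) (f : K → ℝ) (x : K) : S.energyB m f (pointInd x) =
    ∑ p ∈ S.cellsAt m x, (S.rw p.1)⁻¹ * flux p.2 (S.bd (f ∘ S.Fw p.1)) := by
  classical
  rw [energyB_apply]
  simp only [triB_eq_sum, Finset.mul_sum]
  rw [← Fintype.sum_prod_type', cellsAt, Finset.sum_filter]
  refine Finset.sum_congr rfl fun p _ => ?_
  rw [bd_apply, Function.comp_apply]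
  split_ifs with h
  · rw [h, pointInd_self, one_mul]
  · rw [pointInd_of_ne h, zero_mul, mul_zero]

omit [CompactSpace K] [ConnectedSpace K] in
-- Regroups the sum over neighbours into a sum over the corners of cells that sit at `x`.
lemma graphLap_eq {m : ℕ} (f : K → ℝ) (x : K) :
    S.graphLap m f x = - S.energyB m f (pointInd x) := by
  classical
  have h1 : ∀ y, S.cond m x y * (f y - f x) = ∑ w : S.Word m, ∑ i : Fin 3, ∑ j : Fin 3,
      if S.Fw w (S.q j) = y then
        (if i ≠ j ∧ S.Fw w (S.q i) = x then
          (S.rw w)⁻¹ * (f (S.Fw w (S.q j)) - f x) else 0) else 0 := by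
    intro y
    rw [cond, Finset.sum_mul]
    refine Finset.sum_congr rfl fun w _ => ?_
    rw [Finset.sum_mul]
    refine Finset.sum_congr rfl fun i _ => ?_
    rw [Finset.sum_mul]
    refine Finset.sum_congr rfl fun j _ => ?_
    by_cases hy : S.Fw w (S.q j) = y
    · subst hy; simp [ite_mul]
    · simp [hy]
  rw [graphLap, Finset.sum_congr rfl fun y _ => h1 y, Finset.sum_comm, energyB_pointInd, cellsAt,
    Finset.sum_filter, Fintype.sum_prod_type, ← Finset.sum_neg_distrib]
  refine Finset.sum_congr rfl fun w _ => ?_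
  rw [Finset.sum_comm, ← Finset.sum_neg_distrib]
  refine Finset.sum_congr rfl fun i _ => ?_
  rw [Finset.sum_comm]
  have h2 : ∀ j, (∑ y ∈ S.V m, if S.Fw w (S.q j) = y then
        (if i ≠ j ∧ S.Fw w (S.q i) = x then
          (S.rw w)⁻¹ * (f (S.Fw w (S.q j)) - f x) else 0) else 0) =
      if i ≠ j ∧ S.Fw w (S.q i) = x then (S.rw w)⁻¹ * (f (S.Fw w (S.q j)) - f x) else 0 :=
    fun j => by rw [Finset.sum_ite_eq, if_pos (S.mem_V.2 ⟨w, j, rfl⟩)]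
  rw [Finset.sum_congr rfl fun j _ => h2 j]
  by_cases hx : S.Fw w (S.q i) = x
  · subst hx
    have h : (-1 : Fin 3) = 2 := rfl
    fin_cases i <;> simp [Fin.sum_univ_three, flux_apply, bd_apply, h] <;> ring
  · simp [hx]

omit [CompactSpace K] [ConnectedSpace K] in
-- Summation by parts. The right side depends on the weighted graph alone, so the energy is
-- invariant under graph symmetries even though these are not assumed to map cells to cells.
lemma energyB_eq_sum_graphLap (m : ℕ) (u v : K → ℝ) :
    S.energyB m u v = - ∑ x ∈ S.V m, v x * S.graphLap m u x := by
  have h : S.energyB m u v = S.energyB m u (∑ x ∈ S.V m, v x • pointInd x) := by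
    refine S.energyB_congr (fun _ _ => rfl) fun y hy => ?_
    rw [Finset.sum_apply, Finset.sum_eq_single y]
    · simp [pointInd_self]
    · intro x _ hx; simp [pointInd_of_ne hx.symm]
    · intro h; exact absurd hy h
  rw [h, map_sum, ← Finset.sum_neg_distrib]
  refine Finset.sum_congr rfl fun x _ => ?_
  rw [map_smul, graphLap_eq, smul_eq_mul, mul_neg, neg_neg]

variable [BorelSpace K]

lemma moment_add {f g : K → ℝ} (hf : Continuous f) (hg : Continuous g) (i : Fin 3) :
    S.moment (f + g) i = S.moment f i + S.moment g i := by
  rw [moment, moment, moment, ← integral_add]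
  · refine integral_congr_ae (Eventually.of_forall fun y => ?_)
    simp [add_mul]
  · exact S.integrable_of_continuous (hf.mul (ContinuousMap.continuous _))
  · exact S.integrable_of_continuous (hg.mul (ContinuousMap.continuous _))

omit [BorelSpace K] in
lemma moment_smul (a : ℝ) (f : K → ℝ) (i : Fin 3) : S.moment (a • f) i = a * S.moment f i := by
  rw [moment, moment, ← integral_const_mul]
  refine integral_congr_ae (Eventually.of_forall fun y => ?_)
  simp [mul_assoc]

lemma integral_mul_harm {f : K → ℝ} (hf : Continuous f) (u : Fin 3 → ℝ) :
    ∫ y, f y * S.harm u y ∂S.μ = ∑ i, u i * S.moment f i := by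
  simp only [moment, ← integral_const_mul]
  rw [← integral_finsetSum]
  · refine integral_congr_ae (Eventually.of_forall fun y => ?_)
    simp only
    rw [harm_eq_sum, Finset.mul_sum]
    exact Finset.sum_congr rfl fun i _ => by ring
  · intro i _
    exact S.integrable_of_continuous
      (continuous_const.mul (hf.mul (ContinuousMap.continuous _)))

lemma pairing_add {m : ℕ} {f g : K → ℝ} (hf : Continuous f) (hg : Continuous g) (v : K → ℝ) :
    S.pairing m (f + g) v = S.pairing m f v + S.pairing m g v := by
  simp only [pairing, ← Finset.sum_add_distrib]
  refine Finset.sum_congr rfl fun w _ => Finset.sum_congr rfl fun i _ => ?_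
  rw [show (f + g) ∘ S.Fw w = f ∘ S.Fw w + g ∘ S.Fw w from rfl,
    S.moment_add (hf.comp (S.Fw_continuous w)) (hg.comp (S.Fw_continuous w))]
  ring

omit [BorelSpace K] in
lemma pairing_smul {m : ℕ} (a : ℝ) (f v : K → ℝ) :
    S.pairing m (a • f) v = a * S.pairing m f v := by
  simp only [pairing, Finset.mul_sum]
  refine Finset.sum_congr rfl fun w _ => Finset.sum_congr rfl fun i _ => ?_
  rw [show (a • f) ∘ S.Fw w = a • (f ∘ S.Fw w) from rfl, moment_smul]
  ring

/-- A harmonic function is its own piecewise harmonic interpolation at every level, so the pairing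
is always the same integral. -/
lemma pairing_harm (m : ℕ) {f : K → ℝ} (hf : Continuous f) (u : Fin 3 → ℝ) :
    S.pairing m f (S.harm u) = ∑ i, u i * S.moment f i := by
  induction m generalizing f u with
  | zero => simp only [pairing_zero, harm_q]
  | succ m ih =>
    rw [pairing_succ, ← S.integral_mul_harm hf,
      S.integral_eq_sum (f := fun y => f y * S.harm u y) (hf.mul (ContinuousMap.continuous _))]
    refine Finset.sum_congr rfl fun l _ => ?_
    rw [harm_comp_F, ih (hf.comp (S.F_continuous l)),
      ← S.integral_mul_harm (hf.comp (S.F_continuous l)), ← harm_comp_F]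
    rfl

lemma integral_tent {m : ℕ} {x : K} (hx : x ∈ S.V m) :
    ∫ y, S.tent m x y ∂S.μ = S.pairing m 1 (pointInd x) := by
  rw [S.integral_eq_sum_word m S.continuous_tent, pairing]
  refine Finset.sum_congr rfl fun w _ => ?_
  rw [← Finset.mul_sum]
  congr 1
  have h := S.integral_mul_harm (f := 1) continuous_one (S.bd (pointInd x ∘ S.Fw w))
  rw [← S.tent_comp_Fw hx w] at h
  simpa [bd_apply] using h

end Pairing

/-! ### Consequences of the symmetry assumption -/

section Symmetry

variable {K : Type*} [MetricSpace K] [MeasurableSpace K] (S : AnalyticTriangle K)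

/-- `g` is a symmetry of the whole structure, inducing the permutation `σ` of the boundary. -/
structure IsSymmetry (g : K ≃ₜ K) (σ : Equiv.Perm (Fin 3)) : Prop where
  map_q : ∀ i, g (S.q i) = S.q (σ i)
  cond_map : ∀ (m : ℕ) (x y : K), S.cond m (g x) (g y) = S.cond m x y
  map_μ : S.μ.map g = S.μ

lemma cond_nonneg (m : ℕ) (x y : K) : 0 ≤ S.cond m x y := by
  refine Finset.sum_nonneg fun w _ => Finset.sum_nonneg fun i _ => Finset.sum_nonneg fun j _ => ?_
  split_ifs
  · exact inv_nonneg.2 (S.rw_pos w).le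
  · exact le_rfl

open Classical in
lemma cond_ne_zero_iff {m : ℕ} {x y : K} : S.cond m x y ≠ 0 ↔
    ∃ (w : S.Word m) (i j : Fin 3), i ≠ j ∧ S.Fw w (S.q i) = x ∧ S.Fw w (S.q j) = y := by
  constructor
  · intro h
    by_contra hn
    push Not at hn
    refine h (Finset.sum_eq_zero fun w _ => Finset.sum_eq_zero fun i _ =>
      Finset.sum_eq_zero fun j _ => if_neg ?_)
    rintro ⟨h1, h2, h3⟩
    exact hn w i j h1 h2 h3
  · rintro ⟨w, i, j, hij, hx, hy⟩ h0
    have hnn : ∀ (w : S.Word m) (i j : Fin 3), 0 ≤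
        (if i ≠ j ∧ S.Fw w (S.q i) = x ∧ S.Fw w (S.q j) = y then (S.rw w)⁻¹ else 0) := by
      intro w i j
      split_ifs
      · exact inv_nonneg.2 (S.rw_pos w).le
      · exact le_rfl
    have h1 := (Finset.sum_eq_zero_iff_of_nonneg fun w _ =>
      Finset.sum_nonneg fun i _ => Finset.sum_nonneg fun j _ => hnn w i j).1 h0 w
        (Finset.mem_univ w)
    have h2 := (Finset.sum_eq_zero_iff_of_nonneg fun i _ =>
      Finset.sum_nonneg fun j _ => hnn w i j).1 h1 i (Finset.mem_univ i)
    have h3 := (Finset.sum_eq_zero_iff_of_nonneg fun j _ => hnn w i j).1 h2 j (Finset.mem_univ j)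
    rw [if_pos ⟨hij, hx, hy⟩] at h3
    exact inv_ne_zero (S.rw_pos w).ne' h3

/-- Recovers the vertex set from the conductances, which are all that a symmetry is assumed to
preserve. -/
lemma mem_V_iff_cond {m : ℕ} {x : K} : x ∈ S.V m ↔ ∃ y, S.cond m x y ≠ 0 := by
  rw [mem_V]
  constructor
  · rintro ⟨w, i, rfl⟩
    exact ⟨_, S.cond_ne_zero_iff.2 ⟨w, i, i + 1, by fin_cases i <;> decide, rfl, rfl⟩⟩
  · rintro ⟨y, hy⟩
    obtain ⟨w, i, j, -, hx, -⟩ := S.cond_ne_zero_iff.1 hy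
    exact ⟨w, i, hx⟩

variable {S} {g : K ≃ₜ K} {σ : Equiv.Perm (Fin 3)} (hg : S.IsSymmetry g σ)
include hg

lemma IsSymmetry.mem_V_iff {m : ℕ} {x : K} : g x ∈ S.V m ↔ x ∈ S.V m := by
  rw [mem_V_iff_cond, mem_V_iff_cond]
  constructor
  · rintro ⟨y, hy⟩
    exact ⟨g.symm y, by rw [← hg.cond_map, g.apply_symm_apply]; exact hy⟩
  · rintro ⟨y, hy⟩
    exact ⟨g y, by rw [hg.cond_map]; exact hy⟩

lemma IsSymmetry.bd_comp (f : K → ℝ) : S.bd (f ∘ g) = S.bd f ∘ σ := by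
  funext i
  simp [bd_apply, hg.map_q]

lemma IsSymmetry.graphLap_comp (m : ℕ) (f : K → ℝ) (x : K) :
    S.graphLap m (f ∘ g) x = S.graphLap m f (g x) := by
  refine Finset.sum_equiv g.toEquiv (fun y => hg.mem_V_iff.symm) fun y _ => ?_
  simp [hg.cond_map]

lemma IsSymmetry.energyB_comp (m : ℕ) (u v : K → ℝ) :
    S.energyB m (u ∘ g) (v ∘ g) = S.energyB m u v := by
  rw [energyB_eq_sum_graphLap, energyB_eq_sum_graphLap, neg_inj]
  refine Finset.sum_equiv g.toEquiv (fun y => hg.mem_V_iff.symm) fun y _ => ?_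
  rw [hg.graphLap_comp]
  rfl

variable [CompactSpace K] [ConnectedSpace K]

/-- Harmonicity is energy minimization, and both the energy and `V_m` are invariant. -/
lemma IsSymmetry.harm_comp (u : Fin 3 → ℝ) : S.harm u ∘ g = S.harm (u ∘ σ) := by
  have h : S.IsHarmonic (S.harm u ∘ g) := by
    refine ⟨(ContinuousMap.continuous _).comp g.continuous, fun m f hf => ?_⟩
    have h1 := (S.isHarmonic_harm u).2 m (f ∘ g.symm) (by
      intro x hx
      have := hf (g.symm x) (by rw [← hg.mem_V_iff, g.apply_symm_apply]; exact hx)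
      simpa using this)
    rw [energy_eq, energy_eq, ← hg.energyB_comp, ← hg.energyB_comp _ (f ∘ g.symm)] at h1
    rw [energy_eq, energy_eq]
    rwa [show (f ∘ g.symm) ∘ g = f by funext y; simp] at h1
  rw [S.isHarmonic_iff.1 h, hg.bd_comp, bd_harm]

omit [MetricSpace K] [MeasurableSpace K] [CompactSpace K] [ConnectedSpace K] hg in
lemma flux_comp (σ : Equiv.Perm (Fin 3)) (u : Fin 3 → ℝ) (i : Fin 3) :
    flux i (u ∘ σ) = flux (σ i) u := by
  simp only [flux_eq, Function.comp_apply]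
  rw [Equiv.sum_comp σ u]

lemma IsSymmetry.moment_comp [BorelSpace K] (f : K → ℝ) (i : Fin 3) :
    S.moment (f ∘ g) i = S.moment f (σ i) := by
  have h : (Pi.single (σ i) 1 : Fin 3 → ℝ) ∘ σ = Pi.single i 1 := by
    funext j; simp [Pi.single_apply]
  rw [moment, moment, ← h, ← hg.harm_comp]
  conv_rhs => rw [← hg.map_μ]
  rw [g.measurableEmbedding.integral_map]
  rfl

omit hg in
-- The three integrals agree by symmetry, and they add up to the integral of the constant `1`.
lemma moment_one [BorelSpace K] (hsym : S.IsD3Symmetric) (i : Fin 3) : S.moment 1 i = 1 / 3 := by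
  have h1 : ∀ i j, S.moment 1 i = S.moment 1 j := by
    intro i j
    obtain ⟨g, h1, h2, h3⟩ := hsym (Equiv.swap i j)
    have := IsSymmetry.moment_comp ⟨h1, h2, h3⟩ 1 i
    rwa [Equiv.swap_apply_left] at this
  have h2 := S.integral_mul_harm (f := 1) continuous_one (fun _ => 1)
  simp only [harm_const, Pi.one_apply, mul_one, one_mul, integral_const, Fin.sum_univ_three,
    probReal_univ, smul_eq_mul] at h2
  have := h1 i 0
  have := h1 i 1
  have := h1 i 2
  linarith

omit hg in
lemma pairing_one_pointInd [BorelSpace K] (hsym : S.IsD3Symmetric) (m : ℕ) (x : K) :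
    S.pairing m 1 (pointInd x) = (1 / 3) * ∑ p ∈ S.cellsAt m x, S.μw p.1 := by
  rw [pairing_pointInd, Finset.mul_sum]
  refine Finset.sum_congr rfl fun p _ => ?_
  rw [show (1 : K → ℝ) ∘ S.Fw p.1 = 1 from rfl, moment_one hsym, mul_comm]

omit hg in
lemma pairing_one_pointInd_pos [BorelSpace K] (hsym : S.IsD3Symmetric) {m : ℕ} {x : K}
    (hx : x ∈ S.V m) : 0 < S.pairing m 1 (pointInd x) := by
  rw [pairing_one_pointInd hsym]
  obtain ⟨w, i, h⟩ := S.mem_V.1 hx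
  have : 0 < ∑ p ∈ S.cellsAt m x, S.μw p.1 :=
    Finset.sum_pos (fun p _ => S.μw_pos p.1) ⟨(w, i), by simp [cellsAt, h]⟩
  linarith

omit hg [CompactSpace K] [ConnectedSpace K] in
lemma rw_mul_μw (hρ : ∀ l, S.r l * S.wt l = S.ρ) {m : ℕ} (w : S.Word m) :
    S.rw w * S.μw w = S.ρ ^ m := by
  rw [rw, μw, ← Finset.prod_mul_distrib]
  simp [hρ]

omit hg [CompactSpace K] [ConnectedSpace K] in
-- Each cell with corner `x` contributes two edges at `x`, so the sum is half the total conductance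
-- there, a quantity of the graph.
lemma sum_inv_rw (m : ℕ) (x : K) :
    ∑ p ∈ S.cellsAt m x, (S.rw p.1)⁻¹ = -(1 / 2) * S.graphLap m (pointInd x) x := by
  rw [graphLap_eq, energyB_pointInd, neg_mul_neg, Finset.mul_sum]
  refine Finset.sum_congr rfl fun p hp => ?_
  have hp' : S.Fw p.1 (S.q p.2) = x := by simpa [cellsAt] using hp
  have h : S.bd (pointInd x ∘ S.Fw p.1) = Pi.single p.2 1 := by
    funext j
    rw [bd_apply, Function.comp_apply]
    by_cases hj : j = p.2
    · subst hj; rw [hp', pointInd_self, Pi.single_eq_same]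
    · rw [Pi.single_eq_of_ne hj, pointInd_of_ne]
      intro e
      exact hj (S.q_injective (S.Fw_injective p.1 (e.trans hp'.symm)))
  rw [h, flux_eq]
  simp
  ring

omit hg in
lemma pairing_one_pointInd' [BorelSpace K] (hsym : S.IsD3Symmetric)
    (hρ : ∀ l, S.r l * S.wt l = S.ρ) (m : ℕ) (x : K) :
    S.pairing m 1 (pointInd x) = (1 / 3) * S.ρ ^ m * ∑ p ∈ S.cellsAt m x, (S.rw p.1)⁻¹ := by
  rw [pairing_one_pointInd hsym, mul_assoc]
  congr 1
  rw [Finset.mul_sum]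
  refine Finset.sum_congr rfl fun p _ => ?_
  rw [← rw_mul_μw hρ p.1]
  field_simp [(S.rw_pos p.1).ne']

/-- It is not known that `g` permutes cells together with their weights. But `r_w μ_w = ρ^m`
expresses the tent integral through `∑ r_w⁻¹`, which is read off the graph. -/
lemma IsSymmetry.pairing_one_pointInd [BorelSpace K] (hsym : S.IsD3Symmetric)
    (hρ : ∀ l, S.r l * S.wt l = S.ρ) (m : ℕ) (x : K) :
    S.pairing m 1 (pointInd (g x)) = S.pairing m 1 (pointInd x) := by
  rw [pairing_one_pointInd' hsym hρ, pairing_one_pointInd' hsym hρ, sum_inv_rw, sum_inv_rw,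
    ← hg.graphLap_comp]
  have : pointInd (g x) ∘ g = pointInd x := by
    funext y
    by_cases h : y = x
    · subst h; simp [pointInd_self]
    · rw [Function.comp_apply, pointInd_of_ne h, pointInd_of_ne (fun e => h (g.injective e))]
  rw [this]

lemma IsSymmetry.renGraphLap_comp [BorelSpace K] (hsym : S.IsD3Symmetric)
    (hρ : ∀ l, S.r l * S.wt l = S.ρ) {m : ℕ} (f : K → ℝ) {x : K} (hx : x ∈ S.V m) :
    S.renGraphLap m (f ∘ g) x = S.renGraphLap m f (g x) := by
  rw [renGraphLap, renGraphLap, S.integral_tent hx, S.integral_tent (hg.mem_V_iff.2 hx),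
    hg.graphLap_comp, hg.pairing_one_pointInd hsym hρ]

end Symmetry

/-! ### The weak Laplacian and the Dirichlet problem -/

section Poisson

variable {K : Type*} [MetricSpace K] [MeasurableSpace K] [CompactSpace K] [ConnectedSpace K]
  (S : AnalyticTriangle K)

/-- Green's functions of level one. -/
lemma exists_green_one : ∃ ψ : K → C(K, ℝ), ∀ x ∈ S.V 1, x ∉ S.V 0 →
    S.bd (ψ x) = 0 ∧ (∀ l, ψ x ∘ S.F l = S.harm (S.bd (ψ x ∘ S.F l))) ∧
    ∀ v, S.bd v = 0 → S.energyB 1 (ψ x) v = v x := by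
  classical
  let X := {x : K // x ∈ (S.V 1 \ S.V 0 : Finset K)}
  let ext : (X → ℝ) →ₗ[ℝ] (K → ℝ) :=
    ∑ x : X, (LinearMap.proj x : (X → ℝ) →ₗ[ℝ] ℝ).smulRight (pointInd x.1)
  have hext : ∀ a, ext a = ∑ x, a x • pointInd x.1 := fun a => by simp [ext]
  have hextx : ∀ (a : X → ℝ) (x : X), ext a x.1 = a x := by
    intro a x
    rw [hext, Finset.sum_apply, Finset.sum_eq_single x]
    · simp [pointInd_self]
    · intro y _ hy
      rw [Pi.smul_apply, pointInd_of_ne (fun e => hy (Subtype.ext e.symm)), smul_zero]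
    · intro h; exact absurd (Finset.mem_univ x) h
  have hextq : ∀ a, S.bd (ext a) = 0 := by
    intro a
    funext i
    rw [bd_apply, hext, Finset.sum_apply]
    refine Finset.sum_eq_zero fun x _ => ?_
    rw [Pi.smul_apply, pointInd_of_ne, smul_zero]
    intro e
    exact (Finset.mem_sdiff.1 x.2).2 (e ▸ S.q_mem_V 0 i)
  have hextv : ∀ v : K → ℝ, S.bd v = 0 → ∀ y ∈ S.V 1, ext (fun x => v x.1) y = v y := by
    intro v hv y hy
    by_cases h0 : y ∈ S.V 0
    · obtain ⟨i, rfl⟩ := S.mem_V_zero.1 h0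
      exact (congrFun (hextq _) i).trans (congrFun hv i).symm
    · exact hextx (fun x => v x.1) ⟨y, Finset.mem_sdiff.2 ⟨hy, h0⟩⟩
  -- The Gram operator of the level-one energy on functions supported on the interior vertices.
  -- Definiteness makes it invertible, and Green's functions are the columns of its inverse.
  let L : (X → ℝ) →ₗ[ℝ] (X → ℝ) :=
    LinearMap.pi fun x => (S.energyB 1).flip (pointInd x.1) ∘ₗ ext
  have hL : ∀ a b, S.energyB 1 (ext a) (ext b) = ∑ x, b x * L a x := by
    intro a b
    rw [hext b, map_sum]
    refine Finset.sum_congr rfl fun x _ => ?_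
    rw [map_smul]; rfl
  have hinj : Function.Injective L := by
    rw [← LinearMap.ker_eq_bot, LinearMap.ker_eq_bot']
    intro a ha
    have h0 : S.energyB 1 (ext a) (ext a) = 0 := by rw [hL, ha]; simp
    funext x
    obtain ⟨w, i, hw⟩ := S.mem_V.1 (Finset.mem_sdiff.1 x.2).1
    obtain ⟨l, w, rfl⟩ := S.exists_consWord w
    rw [Fw_consWord, Fw_zero] at hw
    have := S.eq_zero_of_energyB_one (hextq a) h0 l i
    rw [← hextx a x, ← hw]; exact this
  have hsurj : Function.Surjective L := LinearMap.injective_iff_surjective.1 hinj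
  have hex : ∀ x : K, ∃ ψ : C(K, ℝ), x ∈ S.V 1 → x ∉ S.V 0 → S.bd ψ = 0 ∧
      (∀ l, ψ ∘ S.F l = S.harm (S.bd (ψ ∘ S.F l))) ∧
      ∀ v, S.bd v = 0 → S.energyB 1 ψ v = v x := by
    intro x
    by_cases hx : x ∈ S.V 1 ∧ x ∉ S.V 0
    swap
    · exact ⟨0, fun h1 h2 => absurd ⟨h1, h2⟩ hx⟩
    let x' : X := ⟨x, Finset.mem_sdiff.2 hx⟩
    obtain ⟨a, ha⟩ := hsurj (Pi.single x' 1)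
    obtain ⟨ψ, hψ⟩ := S.exists_piecewise_harm 1 (ext a)
    have hV : ∀ y ∈ S.V 1, ψ y = ext a y := by
      intro y hy
      obtain ⟨w, i, rfl⟩ := S.mem_V.1 hy
      have := congrFun (hψ w) (S.q i)
      rw [harm_q] at this
      exact this
    refine ⟨ψ, fun _ _ => ⟨?_, fun l => ?_, fun v hv => ?_⟩⟩
    · rw [← hextq a]
      funext i
      exact hV _ (S.q_mem_V 1 i)
    · have h := hψ (fun _ => l)
      have hF : S.Fw (fun _ : Fin 1 => l) = S.F l := by rw [Fw_const]; rfl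
      rw [hF] at h
      conv_lhs => rw [h]
      rw [h, bd_harm]
    · rw [S.energyB_congr hV (fun y hy => (hextv v hv y hy).symm), hL, ha]
      rw [Finset.sum_eq_single x' (fun y _ hy => by rw [Pi.single_eq_of_ne hy, mul_zero])
        (fun h => absurd (Finset.mem_univ _) h), Pi.single_eq_same, mul_one]
  choose ψ hψ using hex
  exact ⟨ψ, hψ⟩

/-- The weak form of `Δ u = g`. -/
def IsWeak (u g : K → ℝ) : Prop :=
  Continuous u ∧ Continuous g ∧ ∀ (m : ℕ) (v : K → ℝ),
    S.energyB m u v = triB (S.bd u) (S.bd v) + S.pairing 0 g v - S.pairing m g v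

lemma isWeak_harm (u : Fin 3 → ℝ) : S.IsWeak (S.harm u) 0 := by
  refine ⟨ContinuousMap.continuous _, continuous_zero, fun m v => ?_⟩
  have h : ∀ n, S.pairing n (0 : K → ℝ) v = 0 := fun n => by
    simpa using S.pairing_smul (m := n) 0 0 v
  rw [energyB_harm, bd_harm, h, h]; ring

variable {S} in
lemma IsWeak.smul {u g : K → ℝ} (h : S.IsWeak u g) (a : ℝ) : S.IsWeak (a • u) (a • g) := by
  obtain ⟨hu, hg, h⟩ := h
  refine ⟨hu.const_smul a, hg.const_smul a, fun m v => ?_⟩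
  rw [map_smul, LinearMap.smul_apply, map_smul, map_smul, LinearMap.smul_apply, h, pairing_smul,
    pairing_smul]
  simp only [smul_eq_mul]; ring

variable [BorelSpace K]

variable {S} in
lemma IsWeak.add {u g u' g' : K → ℝ} (h : S.IsWeak u g) (h' : S.IsWeak u' g') :
    S.IsWeak (u + u') (g + g') := by
  obtain ⟨hu, hg, h⟩ := h
  obtain ⟨hu', hg', h'⟩ := h'
  refine ⟨hu.add hu', hg.add hg', fun m v => ?_⟩
  rw [map_add, LinearMap.add_apply, map_add, map_add, LinearMap.add_apply, h, h',
    S.pairing_add hg hg', S.pairing_add hg hg']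
  ring

variable {S} in
lemma IsWeak.sub {u g u' g' : K → ℝ} (h : S.IsWeak u g) (h' : S.IsWeak u' g') :
    S.IsWeak (u - u') (g - g') := by
  have := h.add (h'.smul (-1))
  rwa [neg_one_smul, neg_one_smul, ← sub_eq_add_neg, ← sub_eq_add_neg] at this

omit [CompactSpace K] [ConnectedSpace K] [BorelSpace K] in
lemma wt_lt_one (l : Fin S.N) : S.wt l < 1 := by
  have h3 := S.three_le
  obtain ⟨l', hl'⟩ : ∃ l' : Fin S.N, l' ≠ l := by
    have : Nontrivial (Fin S.N) := Fin.nontrivial_iff_two_le.2 (by omega)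
    exact exists_ne l
  rw [← S.wt_sum]
  exact Finset.single_lt_sum hl' (Finset.mem_univ l) (Finset.mem_univ l') (S.wt_pos l')
    fun k _ _ => (S.wt_pos k).le

omit [CompactSpace K] [ConnectedSpace K] [BorelSpace K] in
lemma ρ_pos : 0 < S.ρ := mul_pos (S.r_pos _) (S.wt_pos _)

omit [CompactSpace K] [ConnectedSpace K] [BorelSpace K] in
lemma ρ_lt_one : S.ρ < 1 :=
  mul_lt_one_of_nonneg_of_lt_one_left (S.r_pos _).le (S.r_lt_one _) (S.wt_lt_one _).le

omit [BorelSpace K] in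
lemma exists_bound_harm : ∃ C : ℝ, 0 ≤ C ∧ ∀ i x, |S.harm (Pi.single i 1) x| ≤ C := by
  refine ⟨∑ i, ‖S.harm (Pi.single i 1)‖, Finset.sum_nonneg fun i _ => norm_nonneg _,
    fun i x => ?_⟩
  refine ((S.harm (Pi.single i 1)).norm_coe_le_norm x).trans ?_
  exact Finset.single_le_sum (f := fun i => ‖S.harm (Pi.single i 1)‖)
    (fun i _ => norm_nonneg _) (Finset.mem_univ i)

omit [BorelSpace K] in
lemma abs_moment_le {C : ℝ} (hC : ∀ i x, |S.harm (Pi.single i 1) x| ≤ C) {f : K → ℝ} {M : ℝ}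
    (hM : ∀ x, |f x| ≤ M) (i : Fin 3) : |S.moment f i| ≤ M * C := by
  have hM0 : 0 ≤ M := (abs_nonneg _).trans (hM (S.q 0))
  have h := norm_integral_le_of_norm_le_const (μ := S.μ) (C := M * C)
    (f := fun y => f y * S.harm (Pi.single i 1) y) (Eventually.of_forall fun y => by
      rw [Real.norm_eq_abs, abs_mul]
      exact mul_le_mul (hM y) (hC i y) (abs_nonneg _) hM0)
  simpa [moment] using h

omit [BorelSpace K] in
lemma exists_bound_pairing (m : ℕ) (v : K → ℝ) :
    ∃ C : ℝ, 0 ≤ C ∧ ∀ f : C(K, ℝ), |S.pairing m f v| ≤ C * ‖f‖ := by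
  obtain ⟨C, hC0, hC⟩ := S.exists_bound_harm
  refine ⟨∑ w : S.Word m, ∑ i, S.μw w * (|v (S.Fw w (S.q i))| * C),
    Finset.sum_nonneg fun w _ => Finset.sum_nonneg fun i _ => mul_nonneg (S.μw_pos w).le
      (mul_nonneg (abs_nonneg _) hC0), fun f => ?_⟩
  rw [pairing, Finset.sum_mul]
  refine (Finset.abs_sum_le_sum_abs _ _).trans (Finset.sum_le_sum fun w _ => ?_)
  rw [Finset.sum_mul]
  refine (Finset.abs_sum_le_sum_abs _ _).trans (Finset.sum_le_sum fun i _ => ?_)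
  rw [abs_mul, abs_mul, abs_of_pos (S.μw_pos w), mul_assoc, mul_assoc]
  refine mul_le_mul_of_nonneg_left ?_ (S.μw_pos w).le
  refine mul_le_mul_of_nonneg_left ?_ (abs_nonneg _)
  rw [mul_comm C]
  exact S.abs_moment_le hC (fun x => f.norm_coe_le_norm _) i

/-- The level-one part of the solution of the Dirichlet problem for `Δ u = f`. -/
lemma exists_dirichlet_one : ∃ (T : C(K, ℝ) → C(K, ℝ)) (C : ℝ), ∀ f, S.bd (T f) = 0 ∧
    (∀ l, T f ∘ S.F l = S.harm (S.bd (T f ∘ S.F l))) ∧ (∀ x, |T f x| ≤ C * ‖f‖) ∧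
    ∀ v, S.energyB 1 (T f) v = S.pairing 0 f v - S.pairing 1 f v := by
  classical
  obtain ⟨ψ, hψ⟩ := S.exists_green_one
  choose c hc0 hc using fun x : K => S.exists_bound_pairing 1 (pointInd x)
  let X : Finset K := S.V 1 \ S.V 0
  have hX : ∀ x ∈ X, x ∈ S.V 1 ∧ x ∉ S.V 0 := fun x hx => Finset.mem_sdiff.1 hx
  -- The minus sign reflects the convention that `Δ u = f` means energy of `u` against `v` equal to
  -- `-∫ f v` when `v` vanishes on `V₀`.
  let T : C(K, ℝ) → C(K, ℝ) := fun f => -∑ x ∈ X, S.pairing 1 f (pointInd x) • ψ x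
  have hT : ∀ f, (T f : K → ℝ) = -∑ x ∈ X, S.pairing 1 f (pointInd x) • (ψ x : K → ℝ) := by
    intro f; funext y; simp [T]
  have hTb : ∀ f, S.bd (T f) = 0 := by
    intro f
    rw [hT, map_neg, map_sum, neg_eq_zero]
    refine Finset.sum_eq_zero fun x hx => ?_
    rw [map_smul, (hψ x (hX x hx).1 (hX x hx).2).1, smul_zero]
  refine ⟨T, ∑ x ∈ X, c x * ‖ψ x‖, fun f => ⟨hTb f, fun l => ?_, fun y => ?_, fun v => ?_⟩⟩
  · let R : (K → ℝ) →ₗ[ℝ] (K → ℝ) := LinearMap.funLeft ℝ ℝ (S.F l)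
    let Q : (K → ℝ) →ₗ[ℝ] (K → ℝ) :=
      (ContinuousMap.coeFnLinearMap ℝ) ∘ₗ S.harm ∘ₗ S.bd ∘ₗ R
    change R (T f) = Q (T f)
    rw [hT, map_neg, map_neg, map_sum, map_sum]
    refine congrArg _ (Finset.sum_congr rfl fun x hx => ?_)
    rw [map_smul, map_smul]
    exact congrArg _ ((hψ x (hX x hx).1 (hX x hx).2).2.1 l)
  · rw [hT, Pi.neg_apply, abs_neg, Finset.sum_apply, Finset.sum_mul]
    refine (Finset.abs_sum_le_sum_abs _ _).trans (Finset.sum_le_sum fun x _ => ?_)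
    rw [Pi.smul_apply, smul_eq_mul, abs_mul, mul_right_comm]
    exact mul_le_mul (hc x f) ((ψ x).norm_coe_le_norm y) (abs_nonneg _)
      (mul_nonneg (hc0 x) (norm_nonneg _))
  · have h0 : ∀ v, S.bd v = 0 → S.energyB 1 (T f) v = - S.pairing 1 f v := by
      intro v hv
      have hv' : S.pairing 1 f v = S.pairing 1 f (∑ x ∈ X, v x • pointInd x) := by
        refine S.pairing_congr fun y hy => ?_
        rw [Finset.sum_apply]
        by_cases hy0 : y ∈ S.V 0
        · obtain ⟨i, rfl⟩ := S.mem_V_zero.1 hy0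
          rw [Finset.sum_eq_zero]
          · exact congrFun hv i
          · intro x hx
            rw [Pi.smul_apply, pointInd_of_ne (show S.q i ≠ x from fun e => (hX x hx).2 (e ▸ hy0)),
              smul_zero]
        · rw [Finset.sum_eq_single y]
          · simp [pointInd_self]
          · intro x _ hx; simp [pointInd_of_ne hx.symm]
          · intro h; exact absurd (Finset.mem_sdiff.2 ⟨hy, hy0⟩) h
      have hs : S.pairing 1 f (∑ x ∈ X, v x • pointInd x) =
          ∑ x ∈ X, v x * S.pairing 1 f (pointInd x) := by
        have := map_sum (S.pairingₗ 1 f) (fun x => v x • pointInd x) X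
        simp only [map_smul] at this
        exact this
      rw [hv', hs, hT, map_neg, map_sum, LinearMap.neg_apply, LinearMap.sum_apply, neg_inj]
      refine Finset.sum_congr rfl fun x hx => ?_
      rw [map_smul, LinearMap.smul_apply, (hψ x (hX x hx).1 (hX x hx).2).2.2 v hv, smul_eq_mul,
        mul_comm]
    -- A general `v` is reduced to vanishing boundary values; the harmonic part removed produces the
    -- level-zero pairing.
    have h1 := h0 (v - S.harm (S.bd v)) (by rw [map_sub, bd_harm, sub_self])
    rw [map_sub, S.energyB_comm 1 (T f) (S.harm _), energyB_one_harm, hTb, map_zero, sub_zero,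
      pairing_sub_right, S.pairing_harm 1 f.continuous] at h1
    rw [h1, pairing_zero, neg_sub]
    rfl

/-- The solution operator `U` satisfies `U f ∘ F_l = T f ∘ F_l + ρ U (f ∘ F_l)`, with `T` the
level-one solution. As `r_l μ_l = ρ` is the same for all letters, this is a fixed-point equation
with contraction ratio `ρ < 1`. -/
theorem exists_isWeak_of_continuous (hρ : ∀ l, S.r l * S.wt l = S.ρ) {f : K → ℝ}
    (hf : Continuous f) : ∃ u, S.IsWeak u f ∧ S.bd u = 0 := by
  obtain ⟨T, C, hT⟩ := S.exists_dirichlet_one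
  let F' : Fin S.N → C(K, K) := fun l => ⟨S.F l, S.F_continuous l⟩
  have hC : ∀ f : C(K, ℝ), 0 ≤ C * ‖f‖ := fun f => (abs_nonneg _).trans ((hT f).2.2.1 (S.q 0))
  have hC0 : 0 ≤ C := by
    have := hC 1
    have h1 : 0 < ‖(1 : C(K, ℝ))‖ := by
      have := S.nontrivial
      rw [norm_pos_iff]
      intro h
      have := congrArg (fun g : C(K, ℝ) => g (S.q 0)) h
      simp at this
    exact nonneg_of_mul_nonneg_left this h1
  obtain ⟨U, hUq, hUF⟩ := S.exists_selfSimilar (fun l f => f.comp (F' l))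
    (fun f l => (T f).comp (F' l)) S.ρ S.ρ (fun _ _ => 0) (fun _ => 0) (fun f => C * ‖f‖)
    (fun _ _ => rfl)
    (by intro f l l' i j h; simp [F', h])
    (by
      intro f i
      simp only [F', ContinuousMap.comp_apply, ContinuousMap.coe_mk, F_letter_q, mul_zero,
        add_zero]
      exact congrFun (hT f).1 i)
    (by
      intro f l y
      simp only [F', ContinuousMap.comp_apply, ContinuousMap.coe_mk, ContinuousMap.zero_apply,
        mul_zero, add_zero, sub_zero]
      exact (hT f).2.2.1 _)
    (by
      intro f l
      rw [abs_of_pos S.ρ_pos]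
      refine mul_le_mul_of_nonneg_left (mul_le_mul_of_nonneg_left ?_ hC0) S.ρ_pos.le
      rw [ContinuousMap.norm_le _ (norm_nonneg _)]
      exact fun x => f.norm_coe_le_norm _)
    S.ρ_pos.le S.ρ_lt_one
  have hUF' : ∀ f l, (U f : K → ℝ) ∘ S.F l =
      T f ∘ S.F l + S.ρ • (U (f.comp (F' l)) : K → ℝ) := fun f l => funext (hUF f l)
  have hw : ∀ m (f : C(K, ℝ)) v, S.energyB m (U f) v = S.pairing 0 f v - S.pairing m f v := by
    intro m
    induction m with
    | zero =>
      intro f v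
      rw [energyB_zero, show S.bd (U f) = 0 from funext (hUq f), map_zero, sub_self]; rfl
    | succ m ih =>
      intro f v
      -- On each cell `T f` is harmonic, so its energy stops at level one. In the other term `r_l⁻¹
      -- ρ = μ_l`, the weight in the recursion of the pairing.
      have h1 : S.energyB (m + 1) (U f) v = S.energyB 1 (T f) v + (S.pairing 1 f v -
          S.pairing (m + 1) f v) := by
        rw [energyB_succ, energyB_one, pairing_succ, pairing_succ, ← Finset.sum_sub_distrib,
          ← Finset.sum_add_distrib]
        refine Finset.sum_congr rfl fun l _ => ?_
        rw [hUF', map_add, LinearMap.add_apply, map_smul, LinearMap.smul_apply, ih, mul_add]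
        congr 1
        · conv_lhs => rw [(hT f).2.1 l, energyB_harm]
        · have hr := (S.r_pos l).ne'
          rw [← hρ l, smul_eq_mul, ← mul_assoc, ← mul_assoc, inv_mul_cancel₀ hr, one_mul, mul_sub]
          rfl
      rw [h1, (hT f).2.2.2]
      ring
  refine ⟨U ⟨f, hf⟩, ⟨(U ⟨f, hf⟩).continuous, hf, fun m v => ?_⟩, funext (hUq _)⟩
  rw [show S.bd (U ⟨f, hf⟩) = 0 from funext (hUq _), map_zero, LinearMap.zero_apply, zero_add]
  exact hw m ⟨f, hf⟩ v

end Poisson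

/-! ### Equivalence of the pointwise and weak Laplacians; normal derivatives -/

section Laplacian

variable {K : Type*} [MetricSpace K] [MeasurableSpace K] [CompactSpace K] [ConnectedSpace K]
  {S : AnalyticTriangle K}

omit [CompactSpace K] [ConnectedSpace K] in
lemma graphLap_sub (m : ℕ) (f g : K → ℝ) (x : K) :
    S.graphLap m (f - g) x = S.graphLap m f x - S.graphLap m g x := by
  simp only [graphLap_eq, map_sub, LinearMap.sub_apply]; ring

omit [CompactSpace K] [ConnectedSpace K] in
lemma graphLap_add (m : ℕ) (f g : K → ℝ) (x : K) :
    S.graphLap m (f + g) x = S.graphLap m f x + S.graphLap m g x := by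
  simp only [graphLap_eq, map_add, LinearMap.add_apply]; ring

omit [CompactSpace K] [ConnectedSpace K] in
lemma graphLap_smul (m : ℕ) (a : ℝ) (f : K → ℝ) (x : K) :
    S.graphLap m (a • f) x = a * S.graphLap m f x := by
  simp only [graphLap_eq, map_smul, LinearMap.smul_apply, smul_eq_mul]; ring

lemma IsWeak.graphLap_eq {u g : K → ℝ} (h : S.IsWeak u g) (m : ℕ) {x : K} (hx : x ∉ S.V 0) :
    S.graphLap m u x = S.pairing m g (pointInd x) := by
  have hne : ∀ i, S.q i ≠ x := fun i e => hx (S.mem_V_zero.2 ⟨i, e⟩)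
  have hb : S.bd (pointInd x) = 0 := funext fun i => pointInd_of_ne (hne i)
  rw [AnalyticTriangle.graphLap_eq, h.2.2, hb, map_zero, pairing_zero, Finset.sum_eq_zero]
  · ring
  · intro i _; rw [pointInd_of_ne (hne i), zero_mul]

lemma IsWeak.eq_zero {u : K → ℝ} (h : S.IsWeak u 0) (hb : S.bd u = 0) : u = 0 := by
  have hp : ∀ m (v : K → ℝ), S.pairing m (0 : K → ℝ) v = 0 := fun m v => by
    simpa using S.pairing_smul (m := m) 0 0 v
  have hu := S.eqOn_harm_of_energyB_eq (f := u) fun m => by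
    rw [h.2.2, hp, hp]; ring
  rw [hb, map_zero] at hu
  exact S.eq_of_eqOn_vertices h.1 continuous_zero hu

variable [BorelSpace K]

/-- Off the boundary the renormalized graph Laplacian is the integral of `g` against the tent
function, divided by the integral of the latter. The cells at `x` shrink, so this is uniformly close
to `g x`; a uniform bound on the harmonic basis suffices. -/
lemma IsWeak.isLaplacian (hsym : S.IsD3Symmetric) {u g : K → ℝ} (h : S.IsWeak u g) :
    S.IsLaplacian u g := by
  refine ⟨h.1, h.2.1, fun ε hε => ?_⟩
  obtain ⟨C, hC0, hC⟩ := S.exists_bound_harm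
  obtain ⟨η, hη, hηε⟩ : ∃ η > 0, 3 * (η * C) < ε := by
    refine ⟨ε / (3 * C + 3), by positivity, ?_⟩
    rw [show 3 * (ε / (3 * C + 3) * C) = ε * (3 * C) / (3 * C + 3) by ring,
      div_lt_iff₀ (by positivity)]
    nlinarith
  obtain ⟨δ, hδ, hgδ⟩ := Metric.uniformContinuous_iff.1
    (CompactSpace.uniformContinuous_of_continuous h.2.1) η hη
  obtain ⟨M, hM⟩ := S.exists_forall_dist_Fw_lt hδ
  refine ⟨M, fun m hm x hx hx0 => ?_⟩
  have hW := pairing_one_pointInd_pos hsym hx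
  rw [renGraphLap, S.integral_tent hx, h.graphLap_eq m hx0]
  set W := S.pairing m 1 (pointInd x) with hWdef
  have hW3 : ∑ p ∈ S.cellsAt m x, S.μw p.1 = 3 * W := by
    rw [hWdef, pairing_one_pointInd hsym]; ring
  have key : |S.pairing m g (pointInd x) - g x * W| ≤ (η * C) * (3 * W) := by
    rw [← hW3, hWdef, pairing_pointInd, pairing_pointInd, Finset.mul_sum, Finset.mul_sum,
      ← Finset.sum_sub_distrib]
    refine (Finset.abs_sum_le_sum_abs _ _).trans (Finset.sum_le_sum fun p hp => ?_)
    have hp' : S.Fw p.1 (S.q p.2) = x := by simpa [cellsAt] using hp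
    have h1 : S.moment (g ∘ S.Fw p.1) p.2 - g x * S.moment 1 p.2 =
        S.moment (g ∘ S.Fw p.1 + (-g x) • (1 : K → ℝ)) p.2 := by
      rw [S.moment_add (h.2.1.comp (S.Fw_continuous _)) (continuous_one.const_smul _),
        moment_smul]
      ring
    have h2 : |S.moment (g ∘ S.Fw p.1 + (-g x) • (1 : K → ℝ)) p.2| ≤ η * C := by
      refine S.abs_moment_le hC (fun y => ?_) p.2
      have := hgδ (hM m hm p.1 y (S.q p.2))
      rw [hp', Real.dist_eq] at this
      simpa [sub_eq_add_neg] using this.le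
    rw [show S.μw p.1 * S.moment (g ∘ S.Fw p.1) p.2 -
        g x * (S.μw p.1 * S.moment ((1 : K → ℝ) ∘ S.Fw p.1) p.2) =
        S.μw p.1 * (S.moment (g ∘ S.Fw p.1) p.2 - g x * S.moment 1 p.2) by
      rw [show (1 : K → ℝ) ∘ S.Fw p.1 = 1 from rfl]; ring, h1, abs_mul,
      abs_of_pos (S.μw_pos _), mul_comm]
    exact mul_le_mul_of_nonneg_right h2 (S.μw_pos _).le
  rw [show W⁻¹ * S.pairing m g (pointInd x) - g x = W⁻¹ * (S.pairing m g (pointInd x) - g x * W) by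
    field_simp, abs_mul, abs_of_pos (inv_pos.2 hW), inv_mul_lt_iff₀ hW]
  nlinarith

omit [BorelSpace K] in
lemma IsLaplacian.unique {u g g' : K → ℝ} (h : S.IsLaplacian u g) (h' : S.IsLaplacian u g') :
    g = g' := by
  refine S.eq_of_eqOn_vertices_diff h.2.1 h'.2.1 fun m x hx hx0 => ?_
  by_contra hne
  have hpos : 0 < |g x - g' x| / 2 := half_pos (abs_pos.2 (sub_ne_zero.2 hne))
  obtain ⟨M, hM⟩ := h.2.2 _ hpos
  obtain ⟨M', hM'⟩ := h'.2.2 _ hpos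
  have hxn := S.V_mono (le_max_left m (max M M')) hx
  have h1 := hM _ ((le_max_left M M').trans (le_max_right m _)) x hxn hx0
  have h2 := hM' _ ((le_max_right M M').trans (le_max_right m _)) x hxn hx0
  have h3 := abs_sub_le (g x) (S.renGraphLap (max m (max M M')) u x) (g' x)
  rw [abs_sub_comm (g x) (S.renGraphLap _ u x)] at h3
  linarith

omit [CompactSpace K] [ConnectedSpace K] [BorelSpace K] in
lemma IsLaplacian.sub {u g u' g' : K → ℝ} (h : S.IsLaplacian u g) (h' : S.IsLaplacian u' g') :
    S.IsLaplacian (u - u') (g - g') := by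
  refine ⟨h.1.sub h'.1, h.2.1.sub h'.2.1, fun ε hε => ?_⟩
  obtain ⟨M, hM⟩ := h.2.2 _ (half_pos hε)
  obtain ⟨M', hM'⟩ := h'.2.2 _ (half_pos hε)
  refine ⟨max M M', fun m hm x hx hx0 => ?_⟩
  have h1 := abs_lt.1 (hM m ((le_max_left _ _).trans hm) x hx hx0)
  have h2 := abs_lt.1 (hM' m ((le_max_right _ _).trans hm) x hx hx0)
  have h3 : S.renGraphLap m (u - u') x = S.renGraphLap m u x - S.renGraphLap m u' x := by
    rw [renGraphLap, graphLap_sub, mul_sub]; rfl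
  rw [h3, Pi.sub_apply, abs_lt]
  constructor <;> linarith [h1.1, h1.2, h2.1, h2.2]

omit [CompactSpace K] [ConnectedSpace K] [BorelSpace K] in
/-- A function with positive graph Laplacian off the boundary attains its maximum on the
boundary. -/
lemma nonpos_of_graphLap_pos {m : ℕ} {v : K → ℝ} (hb : S.bd v = 0)
    (h : ∀ x ∈ S.V m, x ∉ S.V 0 → 0 < S.graphLap m v x) {x : K} (hx : x ∈ S.V m) : v x ≤ 0 := by
  obtain ⟨y, hy, hmax⟩ := (S.V m).exists_max_image v ⟨x, hx⟩
  refine (hmax x hx).trans ?_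
  by_cases hy0 : y ∈ S.V 0
  · obtain ⟨i, rfl⟩ := S.mem_V_zero.1 hy0
    exact (congrFun hb i).le
  · refine absurd (h y hy hy0) (not_lt.2 (Finset.sum_nonpos fun z hz => ?_))
    exact mul_nonpos_of_nonneg_of_nonpos (S.cond_nonneg m y z) (sub_nonpos.2 (hmax z hz))

/-- Adding `ε e`, where `Δ e = 1` and `e` vanishes on the boundary, makes the graph Laplacian
strictly positive at fine levels. The discrete maximum principle gives `z ≤ ε D`; let `ε` tend to
`0` and repeat with `-z`. -/
lemma IsLaplacian.eq_zero (hsym : S.IsD3Symmetric) (hρ : ∀ l, S.r l * S.wt l = S.ρ) {z : K → ℝ}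
    (h : S.IsLaplacian z 0) (hb : S.bd z = 0) : z = 0 := by
  obtain ⟨e, he, heb⟩ := S.exists_isWeak_of_continuous hρ continuous_one
  obtain ⟨D, hD⟩ : ∃ D, ∀ x, |e x| ≤ D := by
    refine ⟨‖(⟨e, he.1⟩ : C(K, ℝ))‖, fun x => ?_⟩
    exact (⟨e, he.1⟩ : C(K, ℝ)).norm_coe_le_norm x
  have hD0 : 0 ≤ D := (abs_nonneg _).trans (hD (S.q 0))
  have hle : ∀ z : K → ℝ, S.IsLaplacian z 0 → S.bd z = 0 → ∀ ε > 0, ∀ (n : ℕ), ∀ x ∈ S.V n,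
      z x ≤ ε * D := by
    intro z h hb ε hε n x hx
    obtain ⟨M, hM⟩ := h.2.2 ε hε
    have hx' := S.V_mono (le_max_left n M) hx
    have h1 := nonpos_of_graphLap_pos (S := S) (m := max n M) (v := z + ε • e)
      (by rw [map_add, map_smul, hb, heb, smul_zero, add_zero]) (by
        intro y hy hy0
        have h2 := hM _ (le_max_right n M) y hy hy0
        have hW := pairing_one_pointInd_pos hsym hy
        rw [renGraphLap, S.integral_tent hy, Pi.zero_apply, sub_zero, abs_mul,
          abs_of_pos (inv_pos.2 hW), inv_mul_lt_iff₀ hW] at h2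
        rw [graphLap_add, graphLap_smul, he.graphLap_eq _ hy0]
        linarith [(abs_lt.1 h2).1]) hx'
    simp only [Pi.add_apply, Pi.smul_apply, smul_eq_mul] at h1
    nlinarith [(abs_le.1 (hD x)).1]
  have hle0 : ∀ z : K → ℝ, S.IsLaplacian z 0 → S.bd z = 0 → ∀ (n : ℕ), ∀ x ∈ S.V n, z x ≤ 0 := by
    intro z h hb n x hx
    by_contra hpos
    push Not at hpos
    have := hle z h hb (z x / (2 * (D + 1))) (by positivity) n x hx
    rw [div_mul_eq_mul_div, le_div_iff₀ (by positivity)] at this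
    nlinarith
  refine S.eq_of_eqOn_vertices_diff h.1 continuous_zero fun n x hx _ => ?_
  refine le_antisymm (hle0 z h hb n x hx) ?_
  have hz : S.IsLaplacian 0 0 := by
    have := h.sub h
    simpa using this
  have h2 := hle0 (0 - z) (by simpa using hz.sub h) (by rw [map_sub, hb]; simp) n x hx
  simpa using h2

/-- For the converse, compare `u` with the weak solution having the same boundary values and
right-hand side: the difference has Laplacian zero and vanishes on `V₀`. -/
theorem isLaplacian_iff (hsym : S.IsD3Symmetric) (hρ : ∀ l, S.r l * S.wt l = S.ρ)
    {u g : K → ℝ} : S.IsLaplacian u g ↔ S.IsWeak u g := by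
  refine ⟨fun h => ?_, fun h => h.isLaplacian hsym⟩
  obtain ⟨t, ht, htb⟩ := S.exists_isWeak_of_continuous hρ h.2.1
  have hw : S.IsWeak (S.harm (S.bd u) + t) g := by
    have := (S.isWeak_harm (S.bd u)).add ht
    rwa [zero_add] at this
  have h0 : u - (S.harm (S.bd u) + t) = 0 := by
    refine IsLaplacian.eq_zero hsym hρ ?_ ?_
    · have := h.sub (hw.isLaplacian hsym)
      rwa [sub_self] at this
    · rw [map_sub, map_add, bd_harm, htb, add_zero, sub_self]
  rw [sub_eq_zero.1 h0]
  exact hw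

lemma IsWeak.lap_eq (hsym : S.IsD3Symmetric) {u g : K → ℝ} (h : S.IsWeak u g) : S.lap u = g := by
  have H : S.InDomLap u := ⟨g, h.isLaplacian hsym⟩
  rw [lap, dif_pos H]
  exact H.choose_spec.unique (h.isLaplacian hsym)

lemma InDomLap.isWeak (hsym : S.IsD3Symmetric) (hρ : ∀ l, S.r l * S.wt l = S.ρ)
    {u : K → ℝ} (h : S.InDomLap u) : S.IsWeak u (S.lap u) := by
  rw [lap, dif_pos h]
  exact (isLaplacian_iff hsym hρ).1 h.choose_spec

omit [CompactSpace K] [ConnectedSpace K] [BorelSpace K] in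
lemma cellsAt_q (k : ℕ) (l : Fin 3) : S.cellsAt k (S.q l) = {(fun _ => S.letter l, l)} := by
  ext ⟨w, i⟩
  simp only [cellsAt, Finset.mem_filter, Finset.mem_univ, true_and, Finset.mem_singleton,
    Prod.mk.injEq]
  constructor
  · exact S.Fw_eq_q
  · rintro ⟨rfl, rfl⟩
    rw [Fw_const]
    exact Function.iterate_fixed (S.F_letter_q i) k

omit [BorelSpace K] in
-- Test the weak form with the indicator of `q_l`. Only the cell `F_l^k K` contributes at level `k`,
-- and the correction term carries the factor `μ_l^k`, which tends to `0`.
theorem IsWeak.hasNormalDeriv {u g : K → ℝ} (h : S.IsWeak u g) (l : Fin 3) :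
    S.HasNormalDeriv u l (flux l (S.bd u) + S.moment g l) := by
  obtain ⟨C, hC0, hC⟩ := S.exists_bound_harm
  obtain ⟨D, hD⟩ : ∃ D, ∀ x, |g x| ≤ D :=
    ⟨‖(⟨g, h.2.1⟩ : C(K, ℝ))‖, fun x => (⟨g, h.2.1⟩ : C(K, ℝ)).norm_coe_le_norm x⟩
  have key : ∀ k : ℕ, ((S.r (S.letter l)) ^ k)⁻¹ *
      (2 * u (S.q l) - u ((S.F (S.letter l))^[k] (S.q (l + 1)))
        - u ((S.F (S.letter l))^[k] (S.q (l - 1)))) =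
      flux l (S.bd u) + S.moment g l -
        (S.wt (S.letter l)) ^ k * S.moment (g ∘ (S.F (S.letter l))^[k]) l := by
    intro k
    have h1 := h.2.2 k (pointInd (S.q l))
    have hb : S.bd (pointInd (S.q l)) = Pi.single l 1 := by
      funext j
      rw [bd_apply]
      by_cases hj : j = l
      · subst hj; rw [pointInd_self, Pi.single_eq_same]
      · rw [Pi.single_eq_of_ne hj, pointInd_of_ne (fun e => hj (S.q_injective e))]
    have hp0 : S.pairing 0 g (pointInd (S.q l)) = S.moment g l := by
      rw [pairing_pointInd, cellsAt_q, Finset.sum_singleton]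
      simp [μw, Fw_zero]
    rw [hp0, energyB_pointInd, pairing_pointInd, hb, triB_single, cellsAt_q,
      Finset.sum_singleton, Finset.sum_singleton, Fw_const] at h1
    simp only [rw, μw, Finset.prod_const, Finset.card_univ, Fintype.card_fin] at h1
    rw [← h1, flux_apply]
    simp only [bd_apply, Function.comp_apply, Function.iterate_fixed (S.F_letter_q l) k]
  unfold HasNormalDeriv
  simp only [key]
  have hlim : Tendsto (fun k : ℕ => (S.wt (S.letter l)) ^ k *
      S.moment (g ∘ (S.F (S.letter l))^[k]) l) atTop (𝓝 0) := by
    refine (tendsto_pow_atTop_nhds_zero_of_lt_one (S.wt_pos _).le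
      (S.wt_lt_one _)).zero_mul_isBoundedUnder_le ?_
    refine isBoundedUnder_of ⟨D * C, fun k => ?_⟩
    exact S.abs_moment_le hC (fun x => hD _) l
  simpa using hlim.const_sub (flux l (S.bd u) + S.moment g l)

/-- Goes through the pointwise form, which involves only the graphs and tent integrals and is
visibly invariant; the weak form is written in terms of cells. -/
lemma IsWeak.comp_symmetry (hsym : S.IsD3Symmetric) (hρ : ∀ l, S.r l * S.wt l = S.ρ)
    {g : K ≃ₜ K} {σ : Equiv.Perm (Fin 3)} (hg : S.IsSymmetry g σ) {u f : K → ℝ}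
    (h : S.IsWeak u f) : S.IsWeak (u ∘ g) (f ∘ g) := by
  rw [← isLaplacian_iff hsym hρ] at h ⊢
  refine ⟨h.1.comp g.continuous, h.2.1.comp g.continuous, fun ε hε => ?_⟩
  obtain ⟨M, hM⟩ := h.2.2 ε hε
  refine ⟨M, fun m hm x hx hx0 => ?_⟩
  rw [hg.renGraphLap_comp hsym hρ u hx]
  exact hM m hm (g x) (hg.mem_V_iff.2 hx) (fun h0 => hx0 (hg.mem_V_iff.1 h0))

end Laplacian

/-! ### The reflection fixing `q₀` and the eigenvalue `λ` -/

section Reflection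

variable {K : Type*} [MetricSpace K] [MeasurableSpace K] {S : AnalyticTriangle K}

open Classical in
lemma cond_q_ne_zero_iff {k : ℕ} {y : K} : S.cond k (S.q 0) y ≠ 0 ↔
    y = (S.F (S.letter 0))^[k] (S.q 1) ∨ y = (S.F (S.letter 0))^[k] (S.q 2) := by
  rw [cond_ne_zero_iff]
  constructor
  · rintro ⟨w, i, j, hij, hi, rfl⟩
    obtain ⟨rfl, rfl⟩ := S.Fw_eq_q hi
    rw [Fw_const]
    fin_cases j
    · exact absurd rfl hij
    · exact Or.inl rfl
    · exact Or.inr rfl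
  · rintro (rfl | rfl)
    · exact ⟨fun _ => S.letter 0, 0, 1, by decide, by
        rw [Fw_const]; exact Function.iterate_fixed (S.F_letter_q 0) k, by rw [Fw_const]⟩
    · exact ⟨fun _ => S.letter 0, 0, 2, by decide, by
        rw [Fw_const]; exact Function.iterate_fixed (S.F_letter_q 0) k, by rw [Fw_const]⟩

/-- The two points are the neighbours of the fixed point `q₀` in the level-`k` graph. That they are
exchanged, not fixed, needs nondegeneracy. -/
lemma IsSymmetry.map_iterate {g : K ≃ₜ K} {σ : Equiv.Perm (Fin 3)} (hg : S.IsSymmetry g σ)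
    (hσ : σ 0 = 0) (k : ℕ) {y : K}
    (hy : y = (S.F (S.letter 0))^[k] (S.q 1) ∨ y = (S.F (S.letter 0))^[k] (S.q 2)) :
    g y = (S.F (S.letter 0))^[k] (S.q 1) ∨ g y = (S.F (S.letter 0))^[k] (S.q 2) := by
  rw [← cond_q_ne_zero_iff] at hy ⊢
  have h0 : g (S.q 0) = S.q 0 := by rw [hg.map_q, hσ]
  rw [← h0, hg.cond_map]
  exact hy

variable [CompactSpace K] [ConnectedSpace K]

variable (S) in
/-- The harmonic function which is antisymmetric about `q₀`. -/
def skewHarm : C(K, ℝ) := S.harm ![0, 1, -1]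

omit [CompactSpace K] [ConnectedSpace K] in
lemma exists_reflection (hsym : S.IsD3Symmetric) :
    ∃ g : K ≃ₜ K, S.IsSymmetry g (Equiv.swap 1 2) := by
  obtain ⟨g, h1, h2, h3⟩ := hsym (Equiv.swap 1 2)
  exact ⟨g, h1, h2, h3⟩

lemma IsSymmetry.skewHarm_comp {g : K ≃ₜ K} (hg : S.IsSymmetry g (Equiv.swap 1 2)) (y : K) :
    S.skewHarm (g y) = - S.skewHarm y := by
  have h := congrFun (hg.harm_comp ![0, 1, -1]) y
  have hv : (![0, 1, -1] : Fin 3 → ℝ) ∘ Equiv.swap (1 : Fin 3) 2 = -![0, 1, -1] := by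
    funext i
    fin_cases i
    · simp [Equiv.swap_apply_of_ne_of_ne]
    · simp
    · simp
  rw [hv, map_neg] at h
  exact h

lemma skewHarm_F_two (hsym : S.IsD3Symmetric) :
    S.skewHarm (S.F (S.letter 0) (S.q 2)) = - S.skewHarm (S.F (S.letter 0) (S.q 1)) := by
  obtain ⟨g, hg⟩ := exists_reflection hsym
  have hne : S.F (S.letter 0) (S.q 1) ≠ S.F (S.letter 0) (S.q 2) := fun e => by
    simpa using S.q_injective (S.injective _ e)
  have hσ : Equiv.swap (1 : Fin 3) 2 0 = 0 := by decide
  have h1 := hg.map_iterate hσ 1 (Or.inl rfl)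
  have h2 := hg.map_iterate hσ 1 (Or.inr rfl)
  simp only [Function.iterate_one] at h1 h2
  -- If the reflection fixes both points, antisymmetry makes both values zero and the claim still
  -- holds.
  rcases h1 with h1 | h1
  · rcases h2 with h2 | h2
    · exact absurd (g.injective (h1.trans h2.symm)) hne
    · have e1 := hg.skewHarm_comp (S.F (S.letter 0) (S.q 1))
      have e2 := hg.skewHarm_comp (S.F (S.letter 0) (S.q 2))
      rw [h1] at e1
      rw [h2] at e2
      linarith
  · rw [← h1, hg.skewHarm_comp]

/-- On boundary values vanishing at `q₀`, the trace of `M₀` splits into a symmetric contribution `r`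
and the antisymmetric one. The definition of `λ` by the trace thus picks out the antisymmetric
eigenvalue. -/
lemma lam_eq (hsym : S.IsD3Symmetric) : S.lam = S.skewHarm (S.F (S.letter 0) (S.q 1)) := by
  have hadd : S.harm (Pi.single 1 1) + S.harm (Pi.single 2 1) = S.harm ![0, 1, 1] := by
    rw [← map_add]
    congr 1
    funext i
    fin_cases i <;> simp
  have hsub : S.harm (Pi.single 1 1) - S.harm (Pi.single 2 1) = S.skewHarm := by
    rw [← map_sub, skewHarm]
    congr 1
    funext i
    fin_cases i <;> simp
  -- The eigenvalue `r` comes from testing the level-one energy identity with the indicator of `q₀`: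
  -- the flux at `q₀` scales by `r` in the cell `F₀ K`.
  have hr : S.harm ![0, 1, 1] (S.F (S.letter 0) (S.q 1)) +
      S.harm ![0, 1, 1] (S.F (S.letter 0) (S.q 2)) = 2 * S.r0 := by
    have h1 := S.energyB_one_harm ![0, 1, 1] (pointInd (S.q 0))
    have hb : S.bd (pointInd (S.q 0)) = Pi.single 0 1 := by
      funext j
      rw [bd_apply]
      by_cases hj : j = 0
      · subst hj; rw [pointInd_self, Pi.single_eq_same]
      · rw [Pi.single_eq_of_ne hj, pointInd_of_ne (fun e => hj (S.q_injective e))]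
    rw [energyB_pointInd, cellsAt_q, Finset.sum_singleton, Fw_const, hb, triB_single,
      Function.iterate_one] at h1
    have h2 : (-1 : Fin 3) = 2 := rfl
    have h3 := S.harm_q ![0, 1, 1] 0
    have h4 := (S.r_pos (S.letter 0)).ne'
    simp [rw, flux_apply, bd_apply, h2, F_letter_q, harm_q] at h1
    field_simp at h1
    rw [r0]
    linarith
  have hq : S.harm (Pi.single 0 1) (S.q 0) = 1 := by rw [harm_q, Pi.single_eq_same]
  have e1 := congrArg (fun f : C(K, ℝ) => f (S.F (S.letter 0) (S.q 1))) hadd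
  have e2 := congrArg (fun f : C(K, ℝ) => f (S.F (S.letter 0) (S.q 2))) hadd
  have e3 := congrArg (fun f : C(K, ℝ) => f (S.F (S.letter 0) (S.q 1))) hsub
  have e4 := congrArg (fun f : C(K, ℝ) => f (S.F (S.letter 0) (S.q 2))) hsub
  simp only [ContinuousMap.add_apply, ContinuousMap.sub_apply] at e1 e2 e3 e4
  have e5 := skewHarm_F_two hsym
  rw [lam, Matrix.trace, Fin.sum_univ_three]
  simp only [Matrix.diag_apply, extMatrix, Matrix.of_apply, harmExt_eq, F_letter_q, hq]
  linarith

lemma skewHarm_comp_F (hsym : S.IsD3Symmetric) (y : K) :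
    S.skewHarm (S.F (S.letter 0) y) = S.lam * S.skewHarm y := by
  have hb : S.bd (S.skewHarm ∘ S.F (S.letter 0)) = S.lam • ![0, 1, -1] := by
    rw [lam_eq hsym]
    funext i
    rw [bd_apply, Function.comp_apply]
    fin_cases i
    · simp [F_letter_q, skewHarm, harm_q]
    · simp
    · simpa using skewHarm_F_two hsym
  have h := congrFun (S.harm_comp_F ![0, 1, -1] (S.letter 0)) y
  rw [show S.bd (S.harm ![0, 1, -1] ∘ S.F (S.letter 0)) = S.lam • ![0, 1, -1] from hb,
    map_smul] at h
  exact h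

lemma skewHarm_iterate (hsym : S.IsD3Symmetric) (k : ℕ) (y : K) :
    S.skewHarm ((S.F (S.letter 0))^[k] y) = S.lam ^ k * S.skewHarm y := by
  induction k with
  | zero => simp
  | succ k ih => rw [Function.iterate_succ_apply', skewHarm_comp_F hsym, ih]; ring

lemma skewHarm_q_one : S.skewHarm (S.q 1) = 1 := by simp [skewHarm, harm_q]

lemma skewHarm_q_two : S.skewHarm (S.q 2) = -1 := by simp [skewHarm, harm_q]

/-- If `λ = 0`, the vector `(0, 1, -1)` lies in the kernel of `M₀`. -/
lemma lam_ne_zero (hsym : S.IsD3Symmetric) (hnd : S.Nondegenerate) : S.lam ≠ 0 := by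
  intro h0
  refine hnd 0 (Matrix.exists_mulVec_eq_zero_iff.1 ⟨![0, 1, -1], ?_, ?_⟩)
  · intro h; simpa using congrFun h 1
  · funext i
    have h := skewHarm_comp_F hsym (S.q i)
    rw [h0, zero_mul, skewHarm, harm_eq_sum] at h
    simp only [Matrix.mulVec, dotProduct, extMatrix, Matrix.of_apply, harmExt_eq, Pi.zero_apply]
    exact (Finset.sum_congr rfl fun j _ => mul_comm _ _).trans h

/-- The reflection which exchanges `q₁` and `q₂` exchanges `F₀^k q₁` and `F₀^k q₂`. -/
lemma IsSymmetry.map_iterate_one (hsym : S.IsD3Symmetric) (hnd : S.Nondegenerate) {g : K ≃ₜ K}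
    (hg : S.IsSymmetry g (Equiv.swap 1 2)) (k : ℕ) :
    g ((S.F (S.letter 0))^[k] (S.q 1)) = (S.F (S.letter 0))^[k] (S.q 2) := by
  -- Were the point fixed, the antisymmetric harmonic function would vanish there, but its value is
  -- `λ^k`.
  refine (hg.map_iterate (by decide) k (Or.inl rfl)).resolve_left fun h => ?_
  have h1 := hg.skewHarm_comp ((S.F (S.letter 0))^[k] (S.q 1))
  rw [h, skewHarm_iterate hsym, skewHarm_q_one, mul_one] at h1
  exact pow_ne_zero k (lam_ne_zero hsym hnd) (by linarith)

end Reflection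

/-! ### Multiharmonic functions as chains of iterated Laplacians -/

section Chains

variable {K : Type*} [MetricSpace K] [MeasurableSpace K] [CompactSpace K] [ConnectedSpace K]
  {S : AnalyticTriangle K}

variable (S) in
/-- `f` is the sequence of the iterated Laplacians of a function in `𝓗_n`. -/
def IsChain (n : ℕ) (f : ℕ → K → ℝ) : Prop :=
  (∀ i, S.IsWeak (f i) (f (i + 1))) ∧ ∀ i, n < i → f i = 0

variable (S) in
/-- The value of the normal derivative at `q_l` of a function `u` with `Δ u = g`. -/
def normalDeriv (l : Fin 3) (u g : K → ℝ) : ℝ := flux l (S.bd u) + S.moment g l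

lemma isWeak_zero : S.IsWeak 0 0 := by simpa using S.isWeak_harm 0

lemma moment_zero (i : Fin 3) : S.moment 0 i = 0 := by simp [moment]

lemma isChain_zero (n : ℕ) : S.IsChain n 0 := ⟨fun _ => isWeak_zero, fun _ _ => rfl⟩

lemma IsChain.smul {n : ℕ} {f : ℕ → K → ℝ} (h : S.IsChain n f) (a : ℝ) :
    S.IsChain n (fun i => a • f i) :=
  ⟨fun i => (h.1 i).smul a, fun i hi => by simp only [h.2 i hi, smul_zero]⟩

/-- Descending induction from beyond `n`: once `f (i + 1) = 0`, the function `f i` is harmonic, so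
zero boundary values finish the step. -/
lemma IsChain.eq_zero_of_bd {n : ℕ} {f : ℕ → K → ℝ} (h : S.IsChain n f)
    (hb : ∀ i, f (i + 1) = 0 → S.bd (f i) = 0) (i : ℕ) : f i = 0 := by
  have key : ∀ k i, n < i + k → f i = 0 := by
    intro k
    induction k with
    | zero => intro i hi; exact h.2 i hi
    | succ k ih =>
      intro i hi
      have h1 := ih (i + 1) (by omega)
      have h2 := h.1 i
      rw [h1] at h2
      exact h2.eq_zero (hb i h1)
  exact key (n + 1) i (by omega)

variable [BorelSpace K]

lemma IsChain.add {n : ℕ} {f f' : ℕ → K → ℝ} (h : S.IsChain n f) (h' : S.IsChain n f') :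
    S.IsChain n (fun i => f i + f' i) :=
  ⟨fun i => (h.1 i).add (h'.1 i), fun i hi => by simp only [h.2 i hi, h'.2 i hi, add_zero]⟩

lemma IsChain.sub {n : ℕ} {f f' : ℕ → K → ℝ} (h : S.IsChain n f) (h' : S.IsChain n f') :
    S.IsChain n (fun i => f i - f' i) :=
  ⟨fun i => (h.1 i).sub (h'.1 i), fun i hi => by simp only [h.2 i hi, h'.2 i hi, sub_zero]⟩

lemma isChain_sum {ι : Type*} (s : Finset ι) {n : ℕ} {f : ι → ℕ → K → ℝ}
    (h : ∀ p ∈ s, S.IsChain n (f p)) : S.IsChain n (fun i => ∑ p ∈ s, f p i) := by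
  classical
  induction s using Finset.induction_on with
  | empty => exact isChain_zero n
  | insert a s ha ih =>
    simp only [Finset.sum_insert ha]
    exact (h a (Finset.mem_insert_self a s)).add
      (ih fun p hp => h p (Finset.mem_insert_of_mem hp))

lemma IsChain.comp_symmetry (hsym : S.IsD3Symmetric) (hρ : ∀ l, S.r l * S.wt l = S.ρ)
    {g : K ≃ₜ K} {σ : Equiv.Perm (Fin 3)} (hg : S.IsSymmetry g σ) {n : ℕ} {f : ℕ → K → ℝ}
    (h : S.IsChain n f) : S.IsChain n (fun i => f i ∘ g) :=
  ⟨fun i => (h.1 i).comp_symmetry hsym hρ hg, fun i hi => by simp only [h.2 i hi]; rfl⟩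

lemma IsSymmetry.normalDeriv_comp {g : K ≃ₜ K} {σ : Equiv.Perm (Fin 3)} (hg : S.IsSymmetry g σ)
    (l : Fin 3) (u f : K → ℝ) :
    S.normalDeriv l (u ∘ g) (f ∘ g) = S.normalDeriv (σ l) u f := by
  rw [normalDeriv, normalDeriv, hg.bd_comp, flux_comp, hg.moment_comp]

lemma normalDeriv_add {l : Fin 3} {u f u' f' : K → ℝ} (hf : Continuous f) (hf' : Continuous f') :
    S.normalDeriv l (u + u') (f + f') = S.normalDeriv l u f + S.normalDeriv l u' f' := by
  rw [normalDeriv, normalDeriv, normalDeriv, map_add, map_add, S.moment_add hf hf']; ring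

omit [BorelSpace K] in
lemma normalDeriv_smul (l : Fin 3) (a : ℝ) (u f : K → ℝ) :
    S.normalDeriv l (a • u) (a • f) = a * S.normalDeriv l u f := by
  rw [normalDeriv, normalDeriv, map_smul, map_smul, moment_smul, smul_eq_mul]; ring

lemma normalDeriv_sub {l : Fin 3} {u f u' f' : K → ℝ} (hf : Continuous f) (hf' : Continuous f') :
    S.normalDeriv l (u - u') (f - f') = S.normalDeriv l u f - S.normalDeriv l u' f' := by
  have := normalDeriv_add (S := S) (l := l) (u := u) (u' := (-1 : ℝ) • u') hf
    (hf'.const_smul (-1 : ℝ))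
  rw [normalDeriv_smul, neg_one_smul, neg_one_smul, ← sub_eq_add_neg, ← sub_eq_add_neg] at this
  rw [this]; ring

lemma normalDeriv_sum {ι : Type*} (s : Finset ι) {l : Fin 3} {u f : ι → K → ℝ}
    (hf : ∀ p ∈ s, Continuous (f p)) :
    S.normalDeriv l (∑ p ∈ s, u p) (∑ p ∈ s, f p) = ∑ p ∈ s, S.normalDeriv l (u p) (f p) := by
  classical
  induction s using Finset.induction_on with
  | empty => simp [normalDeriv, moment_zero]
  | insert a s ha ih =>
    rw [Finset.sum_insert ha, Finset.sum_insert ha, Finset.sum_insert ha,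
      normalDeriv_add (hf a (Finset.mem_insert_self a s)), ih]
    · exact fun p hp => hf p (Finset.mem_insert_of_mem hp)
    · exact (continuous_finsetSum s fun p hp => hf p (Finset.mem_insert_of_mem hp)).congr
        fun x => (Finset.sum_apply x s f).symm

lemma MemH.isChain (hsym : S.IsD3Symmetric) (hρ : ∀ l, S.r l * S.wt l = S.ρ) {n : ℕ}
    {h : K → ℝ} (hh : S.MemH n h) : S.IsChain n (fun i => S.lap^[i] h) := by
  have hz : ∀ i, n < i → S.lap^[i] h = 0 := by
    intro i hi
    obtain ⟨k, rfl⟩ := Nat.exists_eq_add_of_lt hi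
    rw [show n + k + 1 = k + (n + 1) by ring, Function.iterate_add_apply, hh.2]
    exact Function.iterate_fixed (isWeak_zero.lap_eq hsym) k
  refine ⟨fun i => ?_, hz⟩
  by_cases hi : i ≤ n
  · simp only [Function.iterate_succ_apply']
    exact (hh.1 i hi).isWeak hsym hρ
  · simp only [hz i (by omega), hz (i + 1) (by omega)]
    exact isWeak_zero

lemma IsChain.lap_iterate (hsym : S.IsD3Symmetric) {n : ℕ} {f : ℕ → K → ℝ}
    (h : S.IsChain n f) (i : ℕ) : S.lap^[i] (f 0) = f i := by
  induction i with
  | zero => rfl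
  | succ i ih => rw [Function.iterate_succ_apply', ih, (h.1 i).lap_eq hsym]

lemma IsChain.memH (hsym : S.IsD3Symmetric) {n : ℕ} {f : ℕ → K → ℝ}
    (h : S.IsChain n f) : S.MemH n (f 0) := by
  refine ⟨fun i _ => ?_, ?_⟩
  · rw [h.lap_iterate hsym]
    exact ⟨_, (h.1 i).isLaplacian hsym⟩
  · rw [h.lap_iterate hsym]; exact h.2 _ (Nat.lt_succ_self n)

omit [BorelSpace K] in
lemma normalDeriv_zero_right (l : Fin 3) (u : K → ℝ) :
    S.normalDeriv l u 0 = flux l (S.bd u) := by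
  rw [normalDeriv, moment_zero, add_zero]

/-- If a function in `𝓗_n` has a vanishing symmetric jet at `q₀`, its symmetric part is zero. -/
lemma IsChain.flux_eq_zero (hsym : S.IsD3Symmetric) (hρ : ∀ l, S.r l * S.wt l = S.ρ) {n : ℕ}
    {f : ℕ → K → ℝ} (h : S.IsChain n f) (h0 : ∀ i, f i (S.q 0) = 0)
    (h1 : ∀ i, S.normalDeriv 0 (f i) (f (i + 1)) = 0) : flux 0 (S.bd (f 0)) = 0 := by
  obtain ⟨g, hg⟩ := exists_reflection hsym
  have hσ : Equiv.swap (1 : Fin 3) 2 0 = 0 := by decide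
  -- In the induction for `f i + f i ∘ g`, the function is harmonic, vanishes at `q₀`, takes equal
  -- values at `q₁` and `q₂`, and has zero flux at `q₀`. These conditions force zero boundary
  -- values.
  have hs := (h.add (h.comp_symmetry hsym hρ hg)).eq_zero_of_bd (by
    intro i hi
    have h2 := normalDeriv_add (S := S) (l := 0) (u := f i) (u' := f i ∘ g) (f := f (i + 1))
      (f' := f (i + 1) ∘ g) (h.1 (i + 1)).1 ((h.1 (i + 1)).1.comp g.continuous)
    rw [hi, hg.normalDeriv_comp, hσ, h1, add_zero, normalDeriv_zero_right] at h2
    have e0 : S.bd (f i + f i ∘ g) 0 = 0 := by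
      simp [bd_apply, hg.map_q, hσ, h0]
    have e1 : S.bd (f i + f i ∘ g) 1 = S.bd (f i + f i ∘ g) 2 := by
      simp [bd_apply, hg.map_q, add_comm]
    have h3 : (-1 : Fin 3) = 2 := rfl
    rw [flux_apply, e0] at h2
    simp only [zero_add, zero_sub, h3] at h2
    funext j
    fin_cases j
    · exact e0
    · simp only [Fin.mk_one, Pi.zero_apply]; linarith
    · simp only [Fin.reduceFinMk, Pi.zero_apply]; linarith) 0
  have h4 : flux 0 (S.bd (f 0 + f 0 ∘ g)) = 0 := by rw [hs, map_zero, map_zero]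
  rw [map_add, map_add, hg.bd_comp, flux_comp, hσ] at h4
  linarith

end Chains

/-! ### The monomials `Q_{j1}` and the numbers `α_j` -/

section Monomials

variable {K : Type*} [MetricSpace K] [MeasurableSpace K] [CompactSpace K] [ConnectedSpace K]
  [BorelSpace K] {S : AnalyticTriangle K}

lemma IsWeak.eq_harm {u : K → ℝ} (h : S.IsWeak u 0) : u = S.harm (S.bd u) := by
  have h1 := h.sub (S.isWeak_harm (S.bd u))
  rw [sub_zero] at h1
  exact sub_eq_zero.1 (h1.eq_zero (by rw [map_sub, bd_harm, sub_self]))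

omit [CompactSpace K] [ConnectedSpace K] [BorelSpace K] in
lemma HasNormalDeriv.unique {f : K → ℝ} {l : Fin 3} {d d' : ℝ} (h : S.HasNormalDeriv f l d)
    (h' : S.HasNormalDeriv f l d') : d = d' := tendsto_nhds_unique h h'

/-- The monomials `Q_{j1}^{(0)}`, constructed recursively. -/
lemma exists_monomial_seq (hρ : ∀ l, S.r l * S.wt l = S.ρ) : ∃ G : ℕ → K → ℝ, G 0 = 1 ∧
    ∀ j, S.IsWeak (G (j + 1)) (G j) ∧
      S.bd (G (j + 1)) = (S.moment (G j) 0 / 2) • ![0, 1, 1] := by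
  have step : ∀ f : C(K, ℝ), ∃ u : C(K, ℝ), S.IsWeak u f ∧
      S.bd u = (S.moment f 0 / 2) • ![0, 1, 1] := by
    intro f
    obtain ⟨t, ht, htb⟩ := S.exists_isWeak_of_continuous hρ f.continuous
    -- With boundary values `(0, a, a)` the normal derivative at `q₀` is `-2 a + moment f 0`, which
    -- vanishes exactly for this `a`.
    have h := ht.add (S.isWeak_harm ((S.moment f 0 / 2) • ![0, 1, 1]))
    rw [add_zero] at h
    refine ⟨⟨_, h.1⟩, h, ?_⟩
    change S.bd (t + S.harm ((S.moment f 0 / 2) • ![0, 1, 1])) = _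
    rw [map_add, htb, bd_harm, zero_add]
  choose T hT using step
  refine ⟨fun j => T^[j] 1, rfl, fun j => ?_⟩
  simp only [Function.iterate_succ_apply']
  exact hT _

/-- The chain of iterated Laplacians belonging to the `j`-th term of a sequence `G` with
`Δ G_{j+1} = G_j`. -/
def shiftChain (G : ℕ → K → ℝ) (j : ℕ) : ℕ → K → ℝ := fun i => if i ≤ j then G (j - i) else 0

omit [MetricSpace K] [MeasurableSpace K] [CompactSpace K] [ConnectedSpace K] [BorelSpace K] in
lemma shiftChain_cases (G : ℕ → K → ℝ) (j i : ℕ) :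
    (∃ k, j = i + (k + 1) ∧ shiftChain G j i = G (k + 1) ∧ shiftChain G j (i + 1) = G k) ∨
    (i = j ∧ shiftChain G j i = G 0 ∧ shiftChain G j (i + 1) = 0) ∨
    (j < i ∧ shiftChain G j i = 0 ∧ shiftChain G j (i + 1) = 0) := by
  rcases lt_trichotomy i j with h | h | h
  · left
    obtain ⟨k, rfl⟩ := Nat.exists_eq_add_of_lt h
    refine ⟨k, by ring, ?_, ?_⟩
    · rw [shiftChain, if_pos (by omega)]; congr 1; omega
    · rw [shiftChain, if_pos (by omega)]; congr 1; omega
  · right; left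
    subst h
    exact ⟨rfl, by simp [shiftChain], by simp [shiftChain]⟩
  · right; right
    exact ⟨h, by rw [shiftChain, if_neg (by omega)], by rw [shiftChain, if_neg (by omega)]⟩

omit [BorelSpace K] in
lemma isWeak_one : S.IsWeak 1 0 := by
  have h := S.isWeak_harm fun _ => 1
  rwa [show (S.harm fun _ => 1 : K → ℝ) = 1 from funext (S.harm_const 1)] at h

omit [BorelSpace K] in
lemma isChain_shiftChain {G : ℕ → K → ℝ} (hG0 : G 0 = 1)
    (hG : ∀ j, S.IsWeak (G (j + 1)) (G j)) {j n : ℕ} (hj : j ≤ n) :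
    S.IsChain n (shiftChain G j) := by
  refine ⟨fun i => ?_, fun i hi => by rw [shiftChain, if_neg (by omega)]⟩
  rcases shiftChain_cases G j i with ⟨k, -, h1, h2⟩ | ⟨-, h1, h2⟩ | ⟨-, h1, h2⟩
  · rw [h1, h2]; exact hG k
  · rw [h1, h2, hG0]; exact isWeak_one
  · rw [h1, h2]; exact isWeak_zero

omit [BorelSpace K] in
lemma shiftChain_q_zero {G : ℕ → K → ℝ} (hG0 : G 0 = 1)
    (hG : ∀ j, S.bd (G (j + 1)) = (S.moment (G j) 0 / 2) • ![0, 1, 1]) (j i : ℕ) :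
    shiftChain G j i (S.q 0) = if i = j then 1 else 0 := by
  rcases shiftChain_cases G j i with ⟨k, hk, h1, h2⟩ | ⟨hk, h1, h2⟩ | ⟨hk, h1, h2⟩
  · rw [h1, if_neg (by omega)]
    have := congrFun (hG k) 0
    simpa [bd_apply] using this
  · rw [h1, if_pos hk, hG0]; rfl
  · rw [h1, if_neg (by omega)]; rfl

omit [BorelSpace K] in
lemma normalDeriv_shiftChain {G : ℕ → K → ℝ} (hG0 : G 0 = 1)
    (hG : ∀ j, S.bd (G (j + 1)) = (S.moment (G j) 0 / 2) • ![0, 1, 1]) (j i : ℕ) :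
    S.normalDeriv 0 (shiftChain G j i) (shiftChain G j (i + 1)) = 0 := by
  have h : (-1 : Fin 3) = 2 := rfl
  rcases shiftChain_cases G j i with ⟨k, hk, h1, h2⟩ | ⟨hk, h1, h2⟩ | ⟨hk, h1, h2⟩
  · rw [h1, h2, normalDeriv, hG, flux_apply]
    simp [h]
    ring
  · rw [h1, h2, normalDeriv_zero_right, hG0, flux_apply]
    simp [bd_apply]
    norm_num
  · rw [h1, h2, normalDeriv_zero_right, map_zero, map_zero]

omit [BorelSpace K] in
lemma shiftChain_symm {G : ℕ → K → ℝ} (hG0 : G 0 = 1)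
    (hG : ∀ j, S.bd (G (j + 1)) = (S.moment (G j) 0 / 2) • ![0, 1, 1]) (j i : ℕ) :
    shiftChain G j i (S.q 1) = shiftChain G j i (S.q 2) := by
  rcases shiftChain_cases G j i with ⟨k, hk, h1, h2⟩ | ⟨hk, h1, h2⟩ | ⟨hk, h1, h2⟩
  · rw [h1]
    have e1 := congrFun (hG k) 1
    have e2 := congrFun (hG k) 2
    simp only [bd_apply] at e1 e2
    rw [e1, e2]
    simp
  · rw [h1, hG0]; rfl
  · rw [h1]; rfl

/-- The differences `f i ∘ g - f i` form a chain with zero boundary values at every order. -/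
lemma IsChain.comp_reflection (hsym : S.IsD3Symmetric) (hρ : ∀ l, S.r l * S.wt l = S.ρ)
    {g : K ≃ₜ K} (hg : S.IsSymmetry g (Equiv.swap 1 2)) {n : ℕ} {f : ℕ → K → ℝ}
    (h : S.IsChain n f) (h12 : ∀ i, f i (S.q 1) = f i (S.q 2)) (i : ℕ) : f i ∘ g = f i := by
  refine sub_eq_zero.1 (((h.comp_symmetry hsym hρ hg).sub h).eq_zero_of_bd (fun i _ => ?_) i)
  have hσ : Equiv.swap (1 : Fin 3) 2 0 = 0 := by decide
  funext j
  fin_cases j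
  · simp [bd_apply, hg.map_q, hσ]
  · simp [bd_apply, hg.map_q, h12]
  · simp [bd_apply, hg.map_q, h12]

/-- A function in `𝓗_n` is determined by its jet at `q₀`. -/
lemma IsChain.eq_zero_of_jet (hsym : S.IsD3Symmetric)
    (hnd : S.Nondegenerate) {n : ℕ} {f : ℕ → K → ℝ} (h : S.IsChain n f)
    (h0 : ∀ i, f i (S.q 0) = 0) (h1 : ∀ i, S.normalDeriv 0 (f i) (f (i + 1)) = 0)
    (h2 : ∀ i, S.HasTransDeriv (f i) 0 0) (i : ℕ) : f i = 0 := by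
  refine h.eq_zero_of_bd (fun i hi => ?_) i
  have hm : (-1 : Fin 3) = 2 := rfl
  have e1 := h1 i
  rw [hi, normalDeriv_zero_right, flux_apply] at e1
  simp only [bd_apply, h0, zero_add, zero_sub, hm] at e1
  have hw := h.1 i
  rw [hi] at hw
  -- With zero value and zero flux at `q₀` only the antisymmetric harmonic function is left. Its
  -- transverse difference quotients are constantly `2`, so the transverse derivative detects its
  -- coefficient.
  have hb : S.bd (f i) = f i (S.q 1) • ![0, 1, -1] := by
    funext j
    rw [bd_apply]
    fin_cases j
    · simp [h0]
    · simp
    · simp; linarith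
  have hf : ∀ y, f i y = f i (S.q 1) * S.skewHarm y := by
    intro y
    conv_lhs => rw [hw.eq_harm, hb, map_smul]
    rfl
  have ht := h2 i
  unfold HasTransDeriv at ht
  have hc : ∀ k : ℕ, (S.lam ^ k)⁻¹ * (f i ((S.F (S.letter 0))^[k] (S.q (0 + 1))) -
      f i ((S.F (S.letter 0))^[k] (S.q (0 - 1)))) = 2 * f i (S.q 1) := by
    intro k
    have hl := pow_ne_zero k (lam_ne_zero hsym hnd)
    rw [zero_add, zero_sub, hm, hf, hf ((S.F (S.letter 0))^[k] (S.q 2)), skewHarm_iterate hsym,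
      skewHarm_iterate hsym, skewHarm_q_one, skewHarm_q_two]
    field_simp
    ring
  simp only [hc] at ht
  have h3 := tendsto_nhds_unique ht tendsto_const_nhds
  rw [hb, show f i (S.q 1) = 0 by linarith, zero_smul]

theorem isMonomial_of_seq (hsym : S.IsD3Symmetric) (hρ : ∀ l, S.r l * S.wt l = S.ρ)
    (hnd : S.Nondegenerate) {G : ℕ → K → ℝ} (hG0 : G 0 = 1)
    (hG : ∀ j, S.IsWeak (G (j + 1)) (G j) ∧
      S.bd (G (j + 1)) = (S.moment (G j) 0 / 2) • ![0, 1, 1]) (j : ℕ) :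
    S.IsMonomial j 0 j 1 (G j) ∧ ∀ i, S.HasTransDeriv (shiftChain G j i) 0 0 := by
  have hch := isChain_shiftChain hG0 (fun j => (hG j).1) (le_refl j)
  have hj : shiftChain G j 0 = G j := by simp [shiftChain]
  -- Each function in the chain is reflection invariant and the reflection exchanges `F₀^k q₁` with
  -- `F₀^k q₂`, so every difference quotient is zero.
  have hT : ∀ i, S.HasTransDeriv (shiftChain G j i) 0 0 := by
    intro i
    obtain ⟨g, hg⟩ := exists_reflection hsym
    have hs := hch.comp_reflection hsym hρ hg (shiftChain_symm hG0 (fun j => (hG j).2) j) i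
    have hm : (-1 : Fin 3) = 2 := rfl
    have hc : ∀ k : ℕ, shiftChain G j i ((S.F (S.letter 0))^[k] (S.q (0 + 1))) -
        shiftChain G j i ((S.F (S.letter 0))^[k] (S.q (0 - 1))) = 0 := by
      intro k
      rw [zero_add, zero_sub, hm, ← hg.map_iterate_one hsym hnd k, sub_eq_zero]
      exact (congrFun hs _).symm
    unfold HasTransDeriv
    simp only [hc, mul_zero, tendsto_const_nhds]
  refine ⟨⟨hj ▸ hch.memH hsym, fun i _ => ?_⟩, hT⟩
  rw [← hj, hch.lap_iterate hsym]
  refine ⟨?_, ?_, ?_⟩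
  · rw [shiftChain_q_zero hG0 (fun j => (hG j).2)]; simp
  · have := (hch.1 i).hasNormalDeriv 0
    rw [show flux 0 (S.bd (shiftChain G j i)) + S.moment (shiftChain G j (i + 1)) 0 = 0 from
      normalDeriv_shiftChain hG0 (fun j => (hG j).2) j i] at this
    simpa using this
  · simpa using hT i

/-- The monomial is defined by choice; uniqueness from the jet at `q₀` identifies it with the
constructed `G j`. -/
theorem α_eq (hsym : S.IsD3Symmetric) (hρ : ∀ l, S.r l * S.wt l = S.ρ)
    (hnd : S.Nondegenerate) {G : ℕ → K → ℝ} (hG0 : G 0 = 1)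
    (hG : ∀ j, S.IsWeak (G (j + 1)) (G j) ∧
      S.bd (G (j + 1)) = (S.moment (G j) 0 / 2) • ![0, 1, 1]) (j : ℕ) :
    S.α j = G j (S.q 1) := by
  obtain ⟨hm, hT⟩ := isMonomial_of_seq hsym hρ hnd hG0 hG j
  have H : ∃ Q, S.IsMonomial j 0 j 1 Q := ⟨_, hm⟩
  rw [α, monomial, dif_pos H]
  obtain ⟨hQ, hQj⟩ := H.choose_spec
  set Q := H.choose
  have hj : shiftChain G j 0 = G j := by simp [shiftChain]
  have hq := hQ.isChain hsym hρ
  have hch := isChain_shiftChain hG0 (fun j => (hG j).1) (le_refl j)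
  have hz : ∀ i, j < i → S.lap^[i] Q = 0 := hq.2
  have h0 := (hq.sub hch).eq_zero_of_jet hsym hnd
    (by
      intro i
      rw [Pi.sub_apply, shiftChain_q_zero hG0 (fun j => (hG j).2)]
      by_cases hi : i ≤ j
      · rw [(hQj i hi).1]; simp
      · rw [hz i (by omega), if_neg (by omega)]; simp)
    (by
      intro i
      rw [normalDeriv_sub (hq.1 (i + 1)).1 (hch.1 (i + 1)).1,
        normalDeriv_shiftChain hG0 (fun j => (hG j).2), sub_zero]
      by_cases hi : i ≤ j
      · have h1 := (hQj i hi).2.1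
        rw [if_neg (by omega)] at h1
        exact ((hq.1 i).hasNormalDeriv 0).unique h1
      · change S.normalDeriv 0 (S.lap^[i] Q) (S.lap^[i + 1] Q) = 0
        rw [hz i (by omega), hz (i + 1) (by omega), normalDeriv_zero_right, map_zero, map_zero])
    (by
      intro i
      have h1 : S.HasTransDeriv (S.lap^[i] Q) 0 0 := by
        by_cases hi : i ≤ j
        · have h1 := (hQj i hi).2.2
          rwa [if_neg (by omega)] at h1
        · rw [hz i (by omega)]
          simp [HasTransDeriv]
      have h2 := h1.sub (hT i)
      unfold HasTransDeriv
      rw [sub_zero] at h2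
      refine h2.congr fun k => ?_
      simp only [Pi.sub_apply]
      ring) 0
  have h1 := sub_eq_zero.1 h0
  rw [hj] at h1
  exact congrFun h1 (S.q 1)

theorem α_one (hsym : S.IsD3Symmetric) (hρ : ∀ l, S.r l * S.wt l = S.ρ)
    (hnd : S.Nondegenerate) : S.α 1 = 1 / 6 := by
  obtain ⟨G, hG0, hG⟩ := exists_monomial_seq hρ
  have h := congrFun (hG 0).2 1
  rw [hG0, moment_one hsym, bd_apply] at h
  rw [α_eq hsym hρ hnd hG0 hG, h]
  norm_num

/-- The expansion of the flux at `q₀` of a function in `𝓗_n` whose iterated Laplacians have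
vanishing normal derivatives at `q₀`. -/
theorem IsChain.flux_eq_sum (hsym : S.IsD3Symmetric) (hρ : ∀ l, S.r l * S.wt l = S.ρ)
    (hnd : S.Nondegenerate) {n : ℕ} {f : ℕ → K → ℝ} (h : S.IsChain n f)
    (h1 : ∀ i, S.normalDeriv 0 (f i) (f (i + 1)) = 0) :
    flux 0 (S.bd (f 0)) = -2 * ∑ j ∈ Finset.Icc 1 n, S.α j * f j (S.q 0) := by
  obtain ⟨G, hG0, hG⟩ := exists_monomial_seq hρ
  have hc : ∀ j ∈ Finset.range (n + 1),
      S.IsChain n (fun i => f j (S.q 0) • shiftChain G j i) := fun j hj =>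
    (isChain_shiftChain hG0 (fun j => (hG j).1) (Finset.mem_range_succ_iff.1 hj)).smul _
  have hs := isChain_sum (Finset.range (n + 1)) hc
  -- Subtracting the monomials removes all values at `q₀` without creating normal derivatives.
  -- Transverse derivatives may remain: the antisymmetric part has no flux at `q₀`.
  have h2 := (h.sub hs).flux_eq_zero hsym hρ (by
    intro i
    rw [Pi.sub_apply, Finset.sum_apply, sub_eq_zero]
    simp only [Pi.smul_apply, smul_eq_mul, shiftChain_q_zero hG0 (fun j => (hG j).2), mul_ite,
      mul_one, mul_zero]
    rw [Finset.sum_ite_eq]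
    split_ifs with hi
    · rfl
    · rw [h.2 i (by simpa using hi)]; rfl) (by
    intro i
    rw [normalDeriv_sub (h.1 (i + 1)).1 (hs.1 (i + 1)).1, h1, normalDeriv_sum _
      (fun j hj => ((hc j hj).1 (i + 1)).1), Finset.sum_eq_zero, sub_zero]
    intro j _
    rw [normalDeriv_smul, normalDeriv_shiftChain hG0 (fun j => (hG j).2), mul_zero])
  rw [map_sub, map_sub, sub_eq_zero] at h2
  have hm : (-1 : Fin 3) = 2 := rfl
  -- The monomial vanishes at `q₀` and equals `α` at both other corners. For index zero it is the
  -- constant `1`, without flux, so the final sum starts at `1`.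
  have h3 : ∀ j, flux 0 (S.bd (G (j + 1))) = -2 * S.α (j + 1) := by
    intro j
    rw [α_eq hsym hρ hnd hG0 hG, ← S.bd_apply (G (j + 1)), (hG j).2, flux_apply]
    simp [hm]
    ring
  have h4 : flux 0 (S.bd (1 : K → ℝ)) = 0 := by
    rw [flux_apply]; simp [bd_apply]; norm_num
  have h5 : ∀ (F : ℕ → ℝ) (N : ℕ), ∑ j ∈ Finset.Icc 1 N, F j = ∑ k ∈ Finset.range N, F (k + 1) := by
    intro F N
    induction N with
    | zero => simp
    | succ N ih => rw [Finset.sum_Icc_succ_top (by omega), ih, Finset.sum_range_succ]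
  have h6 : ∀ j, shiftChain G j 0 = G j := fun j => by simp [shiftChain]
  rw [h2, map_sum, map_sum, Finset.sum_range_succ', h5, Finset.mul_sum]
  simp only [map_smul, h6, h3, hG0, h4, mul_zero, add_zero, smul_eq_mul]
  exact Finset.sum_congr rfl fun k _ => by ring

end Monomials

/-! ### Condensing the cells around a vertex into one function -/

section Local

variable {K : Type*} [MetricSpace K] [MeasurableSpace K] [CompactSpace K] [ConnectedSpace K]
  [BorelSpace K] {S : AnalyticTriangle K}

/-- The graph Laplacian at `x` depends only on corner fluxes, so all cells at `x` can be superposed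
on a single copy of `K` with `x` placed at `q₀`. There the flux expansion applies. -/
theorem renGraphLap_of_memLocalH (hsym : S.IsD3Symmetric) (hρ : ∀ l, S.r l * S.wt l = S.ρ)
    (hnd : S.Nondegenerate) {n m : ℕ} {x : K} (hx : x ∈ S.V m) {h : K → ℝ}
    (hh : S.MemLocalH n m x h) {w : S.Word m} {l : Fin 3} (hwl : S.Fw w (S.q l) = x) :
    S.renGraphLap m h x = ∑ j ∈ Finset.Icc 1 n,
      S.ρ ^ (m * (j - 1)) * (S.α 1)⁻¹ * S.α j * S.cellLap w j h (S.q l) := by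
  obtain ⟨hmem, hmatch⟩ := hh
  have hp0 : (w, l) ∈ S.cellsAt m x := by simp [cellsAt, hwl]
  have hex : ∀ i : Fin 3, ∃ g : K ≃ₜ K, S.IsSymmetry g (Equiv.swap 0 i) := by
    intro i
    obtain ⟨g, h1, h2, h3⟩ := hsym (Equiv.swap 0 i)
    exact ⟨g, h1, h2, h3⟩
  choose g hg using hex
  have hρ0 := S.ρ_pos
  -- The scaling factor of the Laplacian is `ρ^m` for every `m`-cell, so the cells can be added at
  -- each order with a common factor.
  have hscale : ∀ (p : S.Word m × Fin 3) (i : ℕ),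
      S.lap^[i] (h ∘ S.Fw p.1) = (S.ρ ^ m) ^ i • S.cellLap p.1 i h := by
    intro p i
    funext y
    rw [Pi.smul_apply, cellLap, rw_mul_μw hρ, smul_eq_mul, mul_inv_cancel_left₀]
    positivity
  have hchain : ∀ p ∈ S.cellsAt m x, S.IsChain n (fun i => S.lap^[i] (h ∘ S.Fw p.1)) :=
    fun p hp => (hmem p hp).isChain hsym hρ
  -- The symmetry `g p.2` carries `q₀` to the corner of the cell that sits at `x`. The weight
  -- `r_w⁻¹` is the one in both the matching condition and the graph Laplacian.
  let c : S.Word m × Fin 3 → ℕ → K → ℝ := fun p i =>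
    (S.rw p.1)⁻¹ • (S.lap^[i] (h ∘ S.Fw p.1) ∘ g p.2)
  have hc : ∀ p ∈ S.cellsAt m x, S.IsChain n (c p) := fun p hp =>
    ((hchain p hp).comp_symmetry hsym hρ (hg p.2)).smul _
  have hf := isChain_sum (S.cellsAt m x) hc
  set R : ℝ := ∑ p ∈ S.cellsAt m x, (S.rw p.1)⁻¹ with hR
  have hRpos : 0 < R := Finset.sum_pos (fun p _ => inv_pos.2 (S.rw_pos _)) ⟨_, hp0⟩
  have hval : ∀ j ≤ n, (∑ p ∈ S.cellsAt m x, c p j) (S.q 0) =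
      R * ((S.ρ ^ m) ^ j * S.cellLap w j h (S.q l)) := by
    intro j hj
    rw [Finset.sum_apply, hR, Finset.sum_mul]
    refine Finset.sum_congr rfl fun p hp => ?_
    have h1 : g p.2 (S.q 0) = S.q p.2 := by rw [(hg p.2).map_q, Equiv.swap_apply_left]
    simp only [c, Pi.smul_apply, Function.comp_apply, smul_eq_mul, h1, hscale p j]
    rw [(hmatch j hj).1 p hp (w, l) hp0]
  have hnor : ∀ i, S.normalDeriv 0 (∑ p ∈ S.cellsAt m x, c p i)
      (∑ p ∈ S.cellsAt m x, c p (i + 1)) = 0 := by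
    intro i
    by_cases hi : i ≤ n
    · obtain ⟨d, hd, hd0⟩ := (hmatch i hi).2
      rw [normalDeriv_sum _ fun p hp => ((hc p hp).1 (i + 1)).1]
      have h1 : ∀ p ∈ S.cellsAt m x, S.normalDeriv 0 (c p i) (c p (i + 1)) =
          (S.ρ ^ m) ^ i * ((S.rw p.1)⁻¹ * d p) := by
        intro p hp
        have h2 : S.HasNormalDeriv (S.lap^[i] (h ∘ S.Fw p.1)) p.2 ((S.ρ ^ m) ^ i * d p) := by
          have h3 := (hd p hp).const_mul ((S.ρ ^ m) ^ i)
          unfold HasNormalDeriv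
          refine h3.congr fun k => ?_
          simp only [hscale p i, Pi.smul_apply, smul_eq_mul]
          ring
        have h3 := (((hchain p hp).1 i).hasNormalDeriv p.2).unique h2
        simp only [c]
        rw [normalDeriv_smul, (hg p.2).normalDeriv_comp, Equiv.swap_apply_left]
        change (S.rw p.1)⁻¹ * (flux p.2 _ + S.moment _ _) = _
        rw [h3]; ring
      rw [Finset.sum_congr rfl h1, ← Finset.mul_sum, hd0, mul_zero]
    · have h1 := hf.2 i (by omega)
      have h2 := hf.2 (i + 1) (by omega)
      simp only at h1 h2
      rw [h1, h2, normalDeriv_zero_right, map_zero, map_zero]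
  have hflux := hf.flux_eq_sum hsym hρ hnd hnor
  have hlap : S.graphLap m h x = - flux 0 (S.bd (∑ p ∈ S.cellsAt m x, c p 0)) := by
    rw [graphLap_eq, energyB_pointInd, map_sum, map_sum, neg_inj]
    refine Finset.sum_congr rfl fun p _ => ?_
    simp only [c, Function.iterate_zero, id_eq]
    rw [map_smul, map_smul, (hg p.2).bd_comp, flux_comp, Equiv.swap_apply_left, smul_eq_mul]
  -- The tent integral is `ρ^m R / 3`, so `R` and one power of `ρ^m` cancel, and the remaining `3 *
  -- 2` is `α₁⁻¹`.
  rw [renGraphLap, S.integral_tent hx, pairing_one_pointInd' hsym hρ, hlap, hflux, ← hR,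
    α_one hsym hρ hnd, ← neg_mul, ← mul_assoc]
  clear_value R
  rw [Finset.mul_sum]
  refine Finset.sum_congr rfl fun j hj => ?_
  obtain ⟨hj1, hjn⟩ := Finset.mem_Icc.1 hj
  rw [hval j hjn]
  obtain ⟨k, rfl⟩ := Nat.exists_eq_add_of_le' hj1
  rw [Nat.add_sub_cancel, pow_mul, pow_succ]
  field_simp
  ring

end Local

end AnalyticTriangle

end

theorem lemma4p3 {K : Type*} [MetricSpace K] [CompactSpace K] [ConnectedSpace K]
    [MeasurableSpace K] [BorelSpace K] (S : AnalyticTriangle K)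
    (hsym : S.IsD3Symmetric)
    (hρ : ∀ l, S.r l * S.wt l = S.ρ)
    (hnd : S.Nondegenerate) :
    (∀ (n m : ℕ) (x : K), x ∈ S.V m → x ∉ S.V 0 →
      ∀ h : K → ℝ, S.MemLocalH n m x h →
        ∀ (w : S.Word m) (l : Fin 3), S.Fw w (S.q l) = x →
          S.renGraphLap m h x =
            ∑ j ∈ Finset.Icc 1 n,
              S.ρ ^ (m * (j - 1)) * (S.α 1)⁻¹ * S.α j * S.cellLap w j h (S.q l)) ∧
    S.α 1 = 1 / 6 := by
  exact ⟨fun n m x hx _ h hh w l hwl =>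
    AnalyticTriangle.renGraphLap_of_memLocalH hsym hρ hnd hx hh hwl,
    AnalyticTriangle.α_one hsym hρ hnd⟩
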